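/- Let $q\in\mathbb C\setminus\{0\}$ be not a root of $1$. Let $A(SL_q(2))$ be the Hopf algebra over $\mathbb C$ generated by $a,b,c,d$ with relations $ab=q^{-1}ba$, $ac=q^{-1}ca$, $bd=q^{-1}db$, $bc=cb$, $cd=q^{-1}dc$, $ad-da=(q^{-1}-q)bc$, $ad-q^{-1}bc=da-qbc=1$, with the usual matrix comultiplication $\Delta$ and counit $\varepsilon$ ($\varepsilon(a)=\varepsilon(d)=1$, $\varepsilon(b)=\varepsilon(c)=0$). Let $\pi:A(SL_q(2))\to\mathbb C[z,z^{-1}]$ be the surjection $a\mapsto z$, $d\mapsto z^{-1}$, $b,c\mapsto 0$, put $\Delta_R=(\mathrm{id}\otimes\pi)\circ\Delta$, and let $A(S_q^2)=\{p\in A(SL_q(2)) : \Delta_R(p)=p\otimes 1\}$ be the coordinate ring of the standard quantum sphere. Let $\tau^0$ be the restriction of $\varepsilon$ to $A(S_q^2)$. There is exactly one linear functional $\tau^1$ on $A(S_q^2)$ such that, with $\zeta=-q^{-1}bc$ and for all integers $m,n\ge 0$, both $\tau^1((ab)^m\zeta^n)$ and $\tau^1((cd)^m\zeta^n)$ equal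 $(1-q^{2n})^{-1}$ if $n>0$ and $m=0$, and equal $0$ otherwise. Both $\tau^0$ and $\tau^1$ are traces, and the pairing $[e]\mapsto\bigl(\tau^0(\mathrm{Tr}\,e),\tau^1(\mathrm{Tr}\,e)\bigr)$, for idempotent matrices $e$ over $A(S_q^2)$, is a well-defined group homomorphism $$(\tau^0,\tau^1):K_0(A(S_q^2))\longrightarrow\mathbb Z\times\mathbb Z .$$ The image under this map of the positive cone of $K_0(A(S_q^2))$ (the set of classes of finitely generated projective modules, equivalently of idempotent matrices) contains $\{1,2,3,\dots\}\times\mathbb Z$. More precisely, for $\mu\in\mathbb Z$ let $e_\mu$ be the $(|\mu|+1)\times(|\mu|+1)$ matrix with entries, for $0\le k,l\le|\mu|$, $$(e_\mu)_{kl}=\begin{cases}a^{-\mu-k}c^{k}\binom{-\mu}{l}_{q^2}(-q)^l b^l d^{-\mu-l} & \text{if }\mu\le 0,\\[2pt] b^{k}d^{\mu-k}\binom{\mu}{l}_{q^2}(-q)^{-l}a^{\mu-l}c^{l} & \text{if }\mu\ge 0,\end{cases}$$ where $\binom{n}{k}_{x}=\frac{(x-1)\cdots(x^n-1)}{(x-1)\cdots(x^k-1)\,(x-1)\cdots(x^{n-k}-1)}$.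 Then $e_\mu$ is an idempotent matrix over $A(S_q^2)$, and for every integer $m\ge 0$ the class $[e_\mu]+m[1]$ lies in the positive cone and is mapped to $(m+1,\mu)$. -/

import Mathlib

open scoped TensorProduct LaurentPolynomial Matrix

noncomputable section

namespace QSphere

/-! ## The coordinate algebra of quantum `SL(2)` -/

/-- The four generators of `A(SL_q(2))`. -/
inductive Gen
  | a | b | c | d

/-- The generator `x` in the free complex algebra on `a, b, c, d`. -/
abbrev fr (x : Gen) : FreeAlgebra ℂ Gen := FreeAlgebra.ι ℂ x

/-- The defining relations of `A(SL_q(2))`. -/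
inductive Rel (q : ℂ) : FreeAlgebra ℂ Gen → FreeAlgebra ℂ Gen → Prop
  | ab : Rel q (fr .a * fr .b) (q⁻¹ • (fr .b * fr .a))
  | ac : Rel q (fr .a * fr .c) (q⁻¹ • (fr .c * fr .a))
  | bd : Rel q (fr .b * fr .d) (q⁻¹ • (fr .d * fr .b))
  | bc : Rel q (fr .b * fr .c) (fr .c * fr .b)
  | cd : Rel q (fr .c * fr .d) (q⁻¹ • (fr .d * fr .c))
  | comm : Rel q (fr .a * fr .d - fr .d * fr .a) ((q⁻¹ - q) • (fr .b * fr .c))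
  | det : Rel q (fr .a * fr .d - q⁻¹ • (fr .b * fr .c)) 1
  | det' : Rel q (fr .d * fr .a - q • (fr .b * fr .c)) 1

/-- The algebra `A(SL_q(2))` over `ℂ`, by generators and relations. -/
def SL (q : ℂ) : Type := RingQuot (Rel q)

instance (q : ℂ) : Ring (SL q) := inferInstanceAs (Ring (RingQuot (Rel q)))

instance (q : ℂ) : Algebra ℂ (SL q) := inferInstanceAs (Algebra ℂ (RingQuot (Rel q)))

variable (q : ℂ)

/-- The quotient map from the free algebra. -/
def proj : FreeAlgebra ℂ Gen →ₐ[ℂ] SL q := RingQuot.mkAlgHom ℂ (Rel q)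

theorem proj_rel {x y : FreeAlgebra ℂ Gen} (h : Rel q x y) : proj q x = proj q y :=
  RingQuot.mkAlgHom_rel ℂ h

/-- The class of a generator in `A(SL_q(2))`. -/
def gen (x : Gen) : SL q := proj q (fr x)

/-- The images of the generators under an algebra map out of `A(SL_q(2))` satisfy these relations. -/
structure IsRep {B : Type} [Ring B] [Algebra ℂ B] (x : Gen → B) : Prop where
  ab : x .a * x .b = q⁻¹ • (x .b * x .a)
  ac : x .a * x .c = q⁻¹ • (x .c * x .a)
  bd : x .b * x .d = q⁻¹ • (x .d * x .b)
  bc : x .b * x .c = x .c * x .b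
  cd : x .c * x .d = q⁻¹ • (x .d * x .c)
  comm : x .a * x .d - x .d * x .a = (q⁻¹ - q) • (x .b * x .c)
  det : x .a * x .d - q⁻¹ • (x .b * x .c) = 1
  det' : x .d * x .a - q • (x .b * x .c) = 1

/-- The universal property of `A(SL_q(2))`. -/
def lift {B : Type} [Ring B] [Algebra ℂ B] (x : Gen → B) (hx : IsRep q x) : SL q →ₐ[ℂ] B :=
  RingQuot.liftAlgHom ℂ (s := Rel q) ⟨FreeAlgebra.lift ℂ x, by
    intro u v h
    cases h <;> simp only [map_mul, map_sub, map_smul, map_one, FreeAlgebra.lift_ι_apply]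
    · exact hx.ab
    · exact hx.ac
    · exact hx.bd
    · exact hx.bc
    · exact hx.cd
    · exact hx.comm
    · exact hx.det
    · exact hx.det'⟩

@[simp] theorem lift_gen {B : Type} [Ring B] [Algebra ℂ B] (x : Gen → B) (hx : IsRep q x)
    (g : Gen) : lift q x hx (gen q g) = x g := by
  exact (RingQuot.liftAlgHom_mkAlgHom_apply ℂ (FreeAlgebra.lift ℂ x) _ (fr g)).trans
    (FreeAlgebra.lift_ι_apply x g)

theorem isRep_gen : IsRep q (gen q) := by
  constructor <;> simp only [gen, ← map_mul, ← map_sub, ← map_smul]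
  · exact proj_rel q Rel.ab
  · exact proj_rel q Rel.ac
  · exact proj_rel q Rel.bd
  · exact proj_rel q Rel.bc
  · exact proj_rel q Rel.cd
  · exact proj_rel q Rel.comm
  · exact (proj_rel q Rel.det).trans (map_one _)
  · exact (proj_rel q Rel.det').trans (map_one _)

/-- The counit on generators: `a, d ↦ 1` and `b, c ↦ 0`. -/
def counitGen : Gen → ℂ
  | .a => 1 | .b => 0 | .c => 0 | .d => 1

/-- The counit `ε` of `A(SL_q(2))`. -/
def counit : SL q →ₐ[ℂ] ℂ := lift q counitGen (by constructor <;> simp [counitGen])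

/-- The comultiplication on generators, `Δ (u_{ij}) = ∑ₖ u_{ik} ⊗ u_{kj}` for the matrix
`u` with rows `(a, b)` and `(c, d)`. -/
def comulGen : Gen → SL q ⊗[ℂ] SL q
  | .a => gen q .a ⊗ₜ gen q .a + gen q .b ⊗ₜ gen q .c
  | .b => gen q .a ⊗ₜ gen q .b + gen q .b ⊗ₜ gen q .d
  | .c => gen q .c ⊗ₜ gen q .a + gen q .d ⊗ₜ gen q .c
  | .d => gen q .c ⊗ₜ gen q .b + gen q .d ⊗ₜ gen q .d

theorem isRep_comulGen (hq : q ≠ 0) : IsRep q (comulGen q) := by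
  have h := isRep_gen q
  have hba : gen q .b * gen q .a = q • (gen q .a * gen q .b) := by
    rw [h.ab, smul_smul, mul_inv_cancel₀ hq, one_smul]
  have hca : gen q .c * gen q .a = q • (gen q .a * gen q .c) := by
    rw [h.ac, smul_smul, mul_inv_cancel₀ hq, one_smul]
  have hdb : gen q .d * gen q .b = q • (gen q .b * gen q .d) := by
    rw [h.bd, smul_smul, mul_inv_cancel₀ hq, one_smul]
  have hdc : gen q .d * gen q .c = q • (gen q .c * gen q .d) := by
    rw [h.cd, smul_smul, mul_inv_cancel₀ hq, one_smul]
  have hcb : gen q .c * gen q .b = gen q .b * gen q .c := h.bc.symm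
  have had : gen q .a * gen q .d = 1 + q⁻¹ • (gen q .b * gen q .c) := by
    rw [← h.det]; abel
  have hda : gen q .d * gen q .a = 1 + q • (gen q .b * gen q .c) := by
    rw [← h.det']; abel
  constructor <;>
  · simp only [comulGen, mul_add, add_mul, Algebra.TensorProduct.tmul_mul_tmul, hba, hca, hdb, hdc,
      hcb, had, hda, TensorProduct.tmul_add, TensorProduct.add_tmul, TensorProduct.tmul_smul,
      ← TensorProduct.smul_tmul', Algebra.TensorProduct.one_def]
    match_scalars <;> field_simp <;> ring

/-- The comultiplication of `A(SL_q(2))`. -/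
def comul (hq : q ≠ 0) : SL q →ₐ[ℂ] SL q ⊗[ℂ] SL q := lift q (comulGen q) (isRep_comulGen q hq)

/-- The surjection onto `ℂ[z, z⁻¹]` on generators: `a ↦ z`, `d ↦ z⁻¹`, `b, c ↦ 0`. -/
def torusGen : Gen → ℂ[T;T⁻¹]
  | .a => LaurentPolynomial.T 1 | .b => 0 | .c => 0 | .d => LaurentPolynomial.T (-1)

/-- The Hopf algebra surjection `π : A(SL_q(2)) → ℂ[z, z⁻¹]`. -/
def torusProj : SL q →ₐ[ℂ] ℂ[T;T⁻¹] :=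
  lift q torusGen (by
    constructor <;>
      simp only [torusGen, mul_zero, zero_mul, smul_zero, sub_zero, ← LaurentPolynomial.T_add,
        add_neg_cancel, neg_add_cancel, LaurentPolynomial.T_zero, sub_self])

/-- The right coaction `Δ_R = (id ⊗ π) ∘ Δ` of `ℂ[z, z⁻¹]` on `A(SL_q(2))`. -/
def coaction (hq : q ≠ 0) : SL q →ₐ[ℂ] SL q ⊗[ℂ] ℂ[T;T⁻¹] :=
  (Algebra.TensorProduct.map (AlgHom.id ℂ (SL q)) (torusProj q)).comp (comul q hq)

/-- The coordinate ring `A(S_q²)` of the standard quantum sphere: the subalgebra of coinvariants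
`{p | Δ_R p = p ⊗ 1}` of `A(SL_q(2))`. -/
def sphere (hq : q ≠ 0) : Subalgebra ℂ (SL q) :=
  AlgHom.equalizer (coaction q hq) Algebra.TensorProduct.includeLeft

variable {q}

theorem mem_sphere (hq : q ≠ 0) (p : SL q) : p ∈ sphere q hq ↔ coaction q hq p = p ⊗ₜ 1 :=
  Iff.rfl

/-- `p` is homogeneous of degree `i`: `Δ_R p = p ⊗ zⁱ`. -/
def HasDeg (hq : q ≠ 0) (p : SL q) (i : ℤ) : Prop :=
  coaction q hq p = p ⊗ₜ LaurentPolynomial.T i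

theorem HasDeg.mul {hq : q ≠ 0} {p r : SL q} {i j : ℤ} (hp : HasDeg hq p i) (hr : HasDeg hq r j) :
    HasDeg hq (p * r) (i + j) := by
  unfold HasDeg at *
  rw [map_mul, hp, hr, Algebra.TensorProduct.tmul_mul_tmul, LaurentPolynomial.T_add]

theorem HasDeg.pow {hq : q ≠ 0} {p : SL q} {i : ℤ} (hp : HasDeg hq p i) (n : ℕ) :
    HasDeg hq (p ^ n) (n * i) := by
  unfold HasDeg at *
  rw [map_pow, hp, Algebra.TensorProduct.tmul_pow, LaurentPolynomial.T_pow]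

theorem HasDeg.smul {hq : q ≠ 0} {p : SL q} {i : ℤ} (hp : HasDeg hq p i) (t : ℂ) :
    HasDeg hq (t • p) i := by
  unfold HasDeg at *
  rw [map_smul, hp, TensorProduct.smul_tmul']

theorem HasDeg.mem {hq : q ≠ 0} {p : SL q} {i : ℤ} (hp : HasDeg hq p i) (hi : i = 0) :
    p ∈ sphere q hq := by
  subst hi
  rw [mem_sphere, hp, LaurentPolynomial.T_zero]

theorem hasDeg_a (hq : q ≠ 0) : HasDeg hq (gen q .a) 1 := by
  simp [HasDeg, coaction, comul, comulGen, torusProj, torusGen]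

theorem hasDeg_b (hq : q ≠ 0) : HasDeg hq (gen q .b) (-1) := by
  simp [HasDeg, coaction, comul, comulGen, torusProj, torusGen]

theorem hasDeg_c (hq : q ≠ 0) : HasDeg hq (gen q .c) 1 := by
  simp [HasDeg, coaction, comul, comulGen, torusProj, torusGen]

theorem hasDeg_d (hq : q ≠ 0) : HasDeg hq (gen q .d) (-1) := by
  simp [HasDeg, coaction, comul, comulGen, torusProj, torusGen]

/-! ## The two traces -/

/-- The element `ab` of `A(S_q²)`. -/
def elemAB (hq : q ≠ 0) : sphere q hq :=
  ⟨gen q .a * gen q .b, ((hasDeg_a hq).mul (hasDeg_b hq)).mem (by norm_num)⟩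

/-- The element `cd` of `A(S_q²)`. -/
def elemCD (hq : q ≠ 0) : sphere q hq :=
  ⟨gen q .c * gen q .d, ((hasDeg_c hq).mul (hasDeg_d hq)).mem (by norm_num)⟩

/-- The element `ζ = -q⁻¹ bc` of `A(S_q²)`. -/
def elemZeta (hq : q ≠ 0) : sphere q hq :=
  ⟨(-q⁻¹) • (gen q .b * gen q .c),
    (((hasDeg_b hq).mul (hasDeg_c hq)).smul (-q⁻¹)).mem (by norm_num)⟩

/-- The trace `τ⁰`: the restriction of the counit to `A(S_q²)`. -/
def tau0 (hq : q ≠ 0) : sphere q hq →ₗ[ℂ] ℂ :=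
  ((counit q).comp (sphere q hq).val).toLinearMap

/-- The defining formula of the Chern trace `τ¹`: both `(ab)ᵐ ζⁿ` and `(cd)ᵐ ζⁿ` are sent to
`(1 - q²ⁿ)⁻¹` if `n > 0` and `m = 0`, and to `0` otherwise. -/
def IsChernTrace (hq : q ≠ 0) (τ : sphere q hq →ₗ[ℂ] ℂ) : Prop :=
  ∀ m n : ℕ,
    τ (elemAB hq ^ m * elemZeta hq ^ n) =
      (if 0 < n ∧ m = 0 then (1 - q ^ (2 * n))⁻¹ else 0) ∧
    τ (elemCD hq ^ m * elemZeta hq ^ n) =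
      (if 0 < n ∧ m = 0 then (1 - q ^ (2 * n))⁻¹ else 0)

/-! ## The projector matrices of the quantum Hopf line bundles -/

/-- `(x - 1)(x² - 1) ⋯ (xⁿ - 1)`. -/
def qFactor (x : ℂ) (n : ℕ) : ℂ := ∏ i ∈ Finset.range n, (x ^ (i + 1) - 1)

/-- The `x`-binomial coefficient (for `x` not a root of unity, `k ≤ n`). -/
def qBinom (x : ℂ) (n k : ℕ) : ℂ := qFactor x n / (qFactor x k * qFactor x (n - k))

/-- The `(k, l)` entry of `e_μ`, with `n = |μ|`, as an element of `A(SL_q(2))`: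
for `μ ≤ 0` it is `aⁿ⁻ᵏ cᵏ · binom(n, l)_{q²} (-q)ˡ bˡ dⁿ⁻ˡ`, and
for `μ > 0` it is `bᵏ dⁿ⁻ᵏ · binom(n, l)_{q²} (-q)⁻ˡ aⁿ⁻ˡ cˡ`. -/
def hopfEntry (q : ℂ) (μ : ℤ) (k l : ℕ) : SL q :=
  if μ ≤ 0 then
    (qBinom (q ^ 2) μ.natAbs l * (-q) ^ l) •
      (gen q .a ^ (μ.natAbs - k) * gen q .c ^ k * (gen q .b ^ l * gen q .d ^ (μ.natAbs - l)))
  else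
    (qBinom (q ^ 2) μ.natAbs l * ((-q) ^ l)⁻¹) •
      (gen q .b ^ k * gen q .d ^ (μ.natAbs - k) * (gen q .a ^ (μ.natAbs - l) * gen q .c ^ l))

theorem hopfEntry_mem (hq : q ≠ 0) (μ : ℤ) (k l : ℕ) (hk : k ≤ μ.natAbs) (hl : l ≤ μ.natAbs) :
    hopfEntry q μ k l ∈ sphere q hq := by
  have ha := hasDeg_a hq
  have hb := hasDeg_b hq
  have hc := hasDeg_c hq
  have hd := hasDeg_d hq
  unfold hopfEntry
  split_ifs
  · refine (((((ha.pow _).mul (hc.pow _)).mul ((hb.pow _).mul (hd.pow _))).smul _).mem ?_)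
    push_cast [Nat.cast_sub hk, Nat.cast_sub hl]
    ring
  · refine (((((hb.pow _).mul (hd.pow _)).mul ((ha.pow _).mul (hc.pow _))).smul _).mem ?_)
    push_cast [Nat.cast_sub hk, Nat.cast_sub hl]
    ring

/-- The projector matrix `e_μ` over `A(S_q²)`, of size `|μ| + 1`. -/
def hopfProj (hq : q ≠ 0) (μ : ℤ) :
    Matrix (Fin (μ.natAbs + 1)) (Fin (μ.natAbs + 1)) (sphere q hq) :=
  Matrix.of fun k l =>
    ⟨hopfEntry q μ k l, hopfEntry_mem hq μ k l (Nat.le_of_lt_succ k.2) (Nat.le_of_lt_succ l.2)⟩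

end QSphere

/-! ## Algebraic `K₀` through idempotent matrices -/

namespace AlgK0

variable {R : Type} [Ring R]

/-- Equivalence of square matrices `e`, `f` of possibly different sizes: `e = u v` and `f = v u` for
rectangular `u`, `v`. For idempotents this says that the finitely generated projective left modules
`Rⁿ e` and `Rᵐ f` are isomorphic. -/
def Equivalent {m n : Type} [Fintype m] [Fintype n] (e : Matrix m m R) (f : Matrix n n R) : Prop :=
  ∃ (u : Matrix m n R) (v : Matrix n m R), u * v = e ∧ v * u = f

theorem Equivalent.refl {m : Type} [Fintype m] {e : Matrix m m R} (he : IsIdempotentElem e) :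
    Equivalent e e := ⟨e, e, he, he⟩

theorem Equivalent.symm {m n : Type} [Fintype m] [Fintype n] {e : Matrix m m R}
    {f : Matrix n n R} (h : Equivalent e f) : Equivalent f e := by
  obtain ⟨u, v, h1, h2⟩ := h
  exact ⟨v, u, h2, h1⟩

theorem Equivalent.trans {m n p : Type} [Fintype m] [Fintype n] [Fintype p] {e : Matrix m m R}
    {f : Matrix n n R} {g : Matrix p p R} (he : IsIdempotentElem e) (hg : IsIdempotentElem g)
    (h : Equivalent e f) (h' : Equivalent f g) : Equivalent e g := by
  obtain ⟨u, v, h1, h2⟩ := h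
  obtain ⟨w, z, h3, h4⟩ := h'
  refine ⟨u * w, z * v, ?_, ?_⟩
  · calc u * w * (z * v) = u * (w * z) * v := by simp only [Matrix.mul_assoc]
      _ = (u * v) * (u * v) := by rw [h3, ← h2]; simp only [Matrix.mul_assoc]
      _ = e := by rw [h1]; exact he
  · calc z * v * (u * w) = z * (v * u) * w := by simp only [Matrix.mul_assoc]
      _ = (z * w) * (z * w) := by rw [h2, ← h3]; simp only [Matrix.mul_assoc]
      _ = g := by rw [h4]; exact hg

theorem Equivalent.reindex {m n : Type} [Fintype m] [Fintype n] [DecidableEq m] [DecidableEq n]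
    (σ : m ≃ n) {e : Matrix m m R} (he : IsIdempotentElem e) :
    Equivalent e (Matrix.reindex σ σ e) := by
  refine ⟨e.submatrix id σ.symm, e.submatrix σ.symm id, ?_, ?_⟩
  · rw [Matrix.submatrix_mul_equiv, he.eq, Matrix.submatrix_id_id]
  · have := Matrix.submatrix_mul e e σ.symm (id : m → m) σ.symm Function.bijective_id
    rw [← this, he.eq]; rfl

/-- The block sum `e ⊕ f`. -/
abbrev block {m n : Type} (e : Matrix m m R) (f : Matrix n n R) : Matrix (m ⊕ n) (m ⊕ n) R :=
  Matrix.fromBlocks e 0 0 f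

theorem isIdempotentElem_block {m n : Type} [Fintype m] [Fintype n] {e : Matrix m m R}
    {f : Matrix n n R} (he : IsIdempotentElem e) (hf : IsIdempotentElem f) :
    IsIdempotentElem (block e f) := by
  simp [IsIdempotentElem, Matrix.fromBlocks_multiply, he.eq, hf.eq]

theorem isIdempotentElem_reindex {m n : Type} [Fintype m] [Fintype n]
    (σ : m ≃ n) {e : Matrix m m R} (he : IsIdempotentElem e) :
    IsIdempotentElem (Matrix.reindex σ σ e) := by
  simp only [IsIdempotentElem, Matrix.reindex_apply]
  rw [Matrix.submatrix_mul_equiv, he.eq]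

theorem Equivalent.block {m n m' n' : Type} [Fintype m] [Fintype n] [Fintype m'] [Fintype n']
    {e : Matrix m m R} {f : Matrix n n R} {e' : Matrix m' m' R} {f' : Matrix n' n' R}
    (h : Equivalent e e') (h' : Equivalent f f') :
    Equivalent (AlgK0.block e f) (AlgK0.block e' f') := by
  obtain ⟨u, v, h1, h2⟩ := h
  obtain ⟨w, z, h3, h4⟩ := h'
  exact ⟨Matrix.fromBlocks u 0 0 w, Matrix.fromBlocks v 0 0 z,
    by simp [Matrix.fromBlocks_multiply, h1, h3], by simp [Matrix.fromBlocks_multiply, h2, h4]⟩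

variable (R)

/-- Idempotent matrices over `R` of arbitrary finite size. -/
structure Idem where
  size : ℕ
  mat : Matrix (Fin size) (Fin size) R
  idem : IsIdempotentElem mat

instance idemSetoid : Setoid (Idem R) where
  r e f := Equivalent e.mat f.mat
  iseqv := ⟨fun e => .refl e.idem, fun h => h.symm, fun {e _ g} h h' => h.trans e.idem g.idem h'⟩

variable {R}

/-- The block sum of idempotent matrices. -/
def Idem.add (e f : Idem R) : Idem R :=
  ⟨e.size + f.size, Matrix.reindex finSumFinEquiv finSumFinEquiv (block e.mat f.mat),
    isIdempotentElem_reindex _ (isIdempotentElem_block e.idem f.idem)⟩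

theorem Idem.add_equivalent (e f : Idem R) :
    Equivalent (block e.mat f.mat) (e.add f).mat :=
  .reindex _ (isIdempotentElem_block e.idem f.idem)

variable (R)

/-- The monoid `V(R)` of equivalence classes of idempotent matrices, that is, of isomorphism classes
of finitely generated projective `R`-modules. -/
def V : Type := Quotient (idemSetoid R)

instance : Add (V R) where
  add := Quotient.map₂ Idem.add (by
    intro e e' h f f' h'
    exact ((Idem.add_equivalent e f).symm.trans (Idem.add e f).idem
      (isIdempotentElem_block e'.idem f'.idem) (Equivalent.block h h')).trans (Idem.add e f).idem
      (Idem.add e' f').idem (Idem.add_equivalent e' f'))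

instance : Zero (V R) where
  zero := Quotient.mk _ ⟨0, 0, by simp [IsIdempotentElem]⟩

instance : AddCommMonoid (V R) where
  add_assoc := by
    rintro ⟨e⟩ ⟨f⟩ ⟨g⟩
    refine Quotient.sound ?_
    have h1 : Equivalent (block (block e.mat f.mat) g.mat) ((e.add f).add g).mat :=
      (Equivalent.block (Idem.add_equivalent e f) (.refl g.idem)).trans
        (isIdempotentElem_block (isIdempotentElem_block e.idem f.idem) g.idem) (Idem.idem _)
        (Idem.add_equivalent _ _)
    have h2 : Equivalent (block e.mat (block f.mat g.mat)) (e.add (f.add g)).mat :=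
      (Equivalent.block (.refl e.idem) (Idem.add_equivalent f g)).trans
        (isIdempotentElem_block e.idem (isIdempotentElem_block f.idem g.idem)) (Idem.idem _)
        (Idem.add_equivalent _ _)
    have h3 := Equivalent.reindex (Equiv.sumAssoc (Fin e.size) (Fin f.size) (Fin g.size))
      (isIdempotentElem_block (isIdempotentElem_block e.idem f.idem) g.idem)
    have h4 : Matrix.reindex (Equiv.sumAssoc (Fin e.size) (Fin f.size) (Fin g.size))
        (Equiv.sumAssoc (Fin e.size) (Fin f.size) (Fin g.size))
        (block (block e.mat f.mat) g.mat) = block e.mat (block f.mat g.mat) := by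
      ext i j
      rcases i with i | i | i <;> rcases j with j | j | j <;> rfl
    rw [h4] at h3
    exact h1.symm.trans (Idem.idem _) (Idem.idem _) (h3.trans
      (isIdempotentElem_block (isIdempotentElem_block e.idem f.idem) g.idem) (Idem.idem _) h2)
  zero_add := by
    rintro ⟨e⟩
    refine Quotient.sound ?_
    refine ((Idem.add_equivalent _ e).symm.trans (Idem.idem _) e.idem
      ⟨Matrix.of fun i j => Sum.elim (fun _ => 0) (fun i => e.mat i j) i,
        Matrix.of fun i j => Sum.elim (fun _ => 0) (fun j => e.mat i j) j, ?_, ?_⟩)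
    · ext i j
      rcases i with i | i
      · exact i.elim0
      · rcases j with j | j
        · exact j.elim0
        · simpa [Matrix.mul_apply] using congrFun (congrFun e.idem i) j
    · ext i j
      simpa [Matrix.mul_apply] using congrFun (congrFun e.idem i) j
  add_zero := by
    rintro ⟨e⟩
    refine Quotient.sound ?_
    refine ((Idem.add_equivalent e _).symm.trans (Idem.idem _) e.idem
      ⟨Matrix.of fun i j => Sum.elim (fun i => e.mat i j) (fun _ => 0) i,
        Matrix.of fun i j => Sum.elim (fun j => e.mat i j) (fun _ => 0) j, ?_, ?_⟩)
    · ext i j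
      rcases i with i | i
      · rcases j with j | j
        · simpa [Matrix.mul_apply] using congrFun (congrFun e.idem i) j
        · exact j.elim0
      · exact i.elim0
    · ext i j
      simpa [Matrix.mul_apply] using congrFun (congrFun e.idem i) j
  add_comm := by
    rintro ⟨e⟩ ⟨f⟩
    refine Quotient.sound ?_
    have h3 := Equivalent.reindex (Equiv.sumComm (Fin e.size) (Fin f.size))
      (isIdempotentElem_block e.idem f.idem)
    have h4 : Matrix.reindex (Equiv.sumComm (Fin e.size) (Fin f.size))
        (Equiv.sumComm (Fin e.size) (Fin f.size)) (block e.mat f.mat) = block f.mat e.mat := by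
      ext i j
      rcases i with i | i <;> rcases j with j | j <;> rfl
    rw [h4] at h3
    exact (Idem.add_equivalent e f).symm.trans (Idem.idem _) (Idem.idem _)
      (h3.trans (isIdempotentElem_block e.idem f.idem) (Idem.idem _) (Idem.add_equivalent f e))
  nsmul := nsmulRec

/-- The algebraic `K₀`-group of `R`: the Grothendieck group of `V(R)`. -/
abbrev K0 : Type := Algebra.GrothendieckAddGroup (V R)

/-- The positive cone of `K₀(R)`: the classes of finitely generated projective modules. -/
def positiveCone : Set (K0 R) := Set.range (Algebra.GrothendieckAddGroup.of (M := V R))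

variable {R}

/-- The class `[e]` of an idempotent matrix in `K₀(R)`. -/
def cls {n : ℕ} (e : Matrix (Fin n) (Fin n) R) (he : IsIdempotentElem e) : K0 R :=
  Algebra.GrothendieckAddGroup.of (Quotient.mk (idemSetoid R) ⟨n, e, he⟩ : V R)

/-- `τ` is a trace (cyclic `0`-cocycle) on the complex algebra `R`. -/
def IsTrace [Algebra ℂ R] (τ : R →ₗ[ℂ] ℂ) : Prop := ∀ x y : R, τ (x * y) = τ (y * x)

end AlgK0

end

noncomputable section

namespace QSphere

/-! ### Elements commuting up to a scalar, and the relations of quantum `SL(2)`. -/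

section QCommute

variable {B : Type*} [Ring B] [Algebra ℂ B] {x y : B} {t : ℂ}

/-! Uniqueness of `τ¹` is a spanning statement. Reordering letters shows that `A(SL_q(2))` is
spanned by the `aⁱbʲcᵏ` and `dⁱbʲcᵏ`. Projecting to degree zero leaves multiples of `(ab)ᵐζⁿ` and
`(cd)ᵐζⁿ`, which therefore span the sphere (`span_sphereMonomials`). Existence needs no linear
independence: `SL q` acts on formal series `∑ fₘ(X) sᵐ` with `ζ` acting as `X²`, and `τ¹` is a
functional of the zeroth coefficient of the image of `1`. The trace property is tested on `ab`,
`cd`, `ζ` against the spanning monomials. The only case with content is `cd` against `ab`, and there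
the values `(1 - q²ⁿ)⁻¹` are what makes it work.

The matrix `e_μ` is a column times a row whose product in the other order is `1`, by induction with
the `q`-Pascal rules; hence it is idempotent. Its trace is a polynomial `g(ζ)` with `g(0) = 1`,
which gives `τ⁰ = 1`. Raising `|μ|` by one changes `g` by `±(f(ζ) - f(q²ζ))` with `f(1) = 0` and
`f(0) = 1`. Since `τ¹` sends `f(ζ) - f(q²ζ)` to `f(1) - f(0)`, each step moves `τ¹` by one, and the
total is `μ`.

The deep point is that `τ¹(Tr e)` is an integer for every idempotent `e`. Suppose first that `q` has
norm less than `1` in a complete normed field. Then the sphere acts on finitely supported sequences,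
each `x` differs from the scalar `ε(x)` by an exponentially decaying matrix, and `τ¹(x)` is the
trace of the difference, because `(1 - q²ⁿ)⁻¹` is a geometric series. For an idempotent, truncations
are almost idempotent. Newton iteration replaces them by true idempotents, and close idempotents
have equal trace. So truncated traces, corrected by multiples of the rank of `ε(e)`, converge to a
fixed integer (`IsExpClose.exists_hasSum_eq_intCast`).

For other `q`, notably on the unit circle, the claim is transported along a field embedding. A
nonzero `q` that is not a root of unity becomes small under some embedding of `ℂ` into a complete
normed field (`exists_complete_normedField_norm_lt_one`). If `q` is transcendental, an automorphism
of `ℂ` rescales it. If `q⁻¹` is an algebraic integer, Kronecker's theorem supplies a conjugate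
outside the unit disc. Otherwise some `p`-adic conjugate of `q⁻¹` is large. -/

theorem pow_mul_of_qcommute (h : y * x = t • (x * y)) (n : ℕ) :
    y ^ n * x = t ^ n • (x * y ^ n) := by
  induction n with
  | zero => simp
  | succ n ih =>
    rw [pow_succ, mul_assoc, h, mul_smul_comm, ← mul_assoc, ih, smul_mul_assoc, smul_smul,
      mul_assoc, ← pow_succ, ← pow_succ']

theorem mul_pow_of_qcommute (h : y * x = t • (x * y)) (n : ℕ) :
    y * x ^ n = t ^ n • (x ^ n * y) := by
  induction n with
  | zero => simp
  | succ n ih =>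
    rw [pow_succ, ← mul_assoc, ih, smul_mul_assoc, mul_assoc, h, mul_smul_comm, smul_smul,
      ← mul_assoc, ← pow_succ]

theorem pow_mul_pow_of_qcommute (h : y * x = t • (x * y)) (m n : ℕ) :
    y ^ m * x ^ n = t ^ (m * n) • (x ^ n * y ^ m) := by
  rw [pow_mul, ← mul_pow_of_qcommute (pow_mul_of_qcommute h m)]

theorem exists_pow_mul_pow_eq_smul (h : y * x = t • (x * y)) (n : ℕ) :
    ∃ s : ℂ, y ^ n * x ^ n = s • (x * y) ^ n := by
  induction n with
  | zero => exact ⟨1, by simp⟩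
  | succ n ih =>
    obtain ⟨s, hs⟩ := ih
    have h1 : y * (x * y) = t • (x * y * y) := by rw [← mul_assoc, h, smul_mul_assoc]
    refine ⟨s * (t ^ n * t), ?_⟩
    rw [pow_succ', pow_succ, mul_assoc, ← mul_assoc (y ^ n), hs, smul_mul_assoc, mul_smul_comm,
      ← mul_assoc, mul_pow_of_qcommute h1, smul_mul_assoc, mul_assoc, h, mul_smul_comm, ← pow_succ,
      smul_smul, smul_smul, mul_assoc]

end QCommute

namespace IsRep

variable {q : ℂ} {B : Type} [Ring B] [Algebra ℂ B] {x : Gen → B} (h : IsRep q x)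
include h

theorem ba (hq : q ≠ 0) : x .b * x .a = q • (x .a * x .b) := by
  rw [h.ab, smul_smul, mul_inv_cancel₀ hq, one_smul]

theorem ca (hq : q ≠ 0) : x .c * x .a = q • (x .a * x .c) := by
  rw [h.ac, smul_smul, mul_inv_cancel₀ hq, one_smul]

theorem db (hq : q ≠ 0) : x .d * x .b = q • (x .b * x .d) := by
  rw [h.bd, smul_smul, mul_inv_cancel₀ hq, one_smul]

theorem dc (hq : q ≠ 0) : x .d * x .c = q • (x .c * x .d) := by
  rw [h.cd, smul_smul, mul_inv_cancel₀ hq, one_smul]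

end IsRep

/-! ### A monomial spanning set of `A(SL_q(2))` and the degree-zero projection. -/

variable {q : ℂ}

variable (q) in
/-- The monomials `aⁱ bʲ cᵏ` and `dⁱ bʲ cᵏ`. -/
def monomials : Set (SL q) :=
  (Set.range fun i : ℕ × ℕ × ℕ => gen q .a ^ i.1 * (gen q .b ^ i.2.1 * gen q .c ^ i.2.2)) ∪
  (Set.range fun i : ℕ × ℕ × ℕ => gen q .d ^ i.1 * (gen q .b ^ i.2.1 * gen q .c ^ i.2.2))

theorem a_monomial_mem (i j k : ℕ) :
    gen q .a ^ i * (gen q .b ^ j * gen q .c ^ k) ∈ Submodule.span ℂ (monomials q) :=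
  Submodule.subset_span (Or.inl ⟨(i, j, k), rfl⟩)

theorem d_monomial_mem (i j k : ℕ) :
    gen q .d ^ i * (gen q .b ^ j * gen q .c ^ k) ∈ Submodule.span ℂ (monomials q) :=
  Submodule.subset_span (Or.inr ⟨(i, j, k), rfl⟩)

/-- Moving `a` or `d` left past `bʲcᵏ` costs only a power of `q`. If it then meets the opposite
letter, `ad` and `da` have the form `1 + t bc`, and the factor `bc` is absorbed into `bʲ⁺¹cᵏ⁺¹`. So
the span is a right ideal, and it contains `1`. -/
theorem span_monomials_mul_gen (hq : q ≠ 0) {s : SL q} (hs : s ∈ Submodule.span ℂ (monomials q))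
    (g : Gen) : s * gen q g ∈ Submodule.span ℂ (monomials q) := by
  have h := isRep_gen q
  have hbc : Commute (gen q .b) (gen q .c) := h.bc
  induction hs using Submodule.span_induction with
  | zero => simp
  | add x y _ _ hx hy => rw [add_mul]; exact add_mem hx hy
  | smul t x _ hx => rw [smul_mul_assoc]; exact Submodule.smul_mem _ _ hx
  | mem x hx =>
    have hb (y : SL q) (j k : ℕ) : y * (gen q .b ^ j * gen q .c ^ k) * gen q .b =
        y * (gen q .b ^ (j + 1) * gen q .c ^ k) := by
      rw [mul_assoc, mul_assoc, ← (hbc.pow_right k).eq, ← mul_assoc (gen q .b ^ j), ← pow_succ]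
    have hc (y : SL q) (j k : ℕ) : y * (gen q .b ^ j * gen q .c ^ k) * gen q .c =
        y * (gen q .b ^ j * gen q .c ^ (k + 1)) := by
      rw [mul_assoc, mul_assoc, ← pow_succ]
    have ha (y : SL q) (j k : ℕ) : y * (gen q .b ^ j * gen q .c ^ k) * gen q .a =
        (q ^ k * q ^ j) • (y * gen q .a * (gen q .b ^ j * gen q .c ^ k)) := by
      rw [mul_assoc, mul_assoc, pow_mul_of_qcommute (h.ca hq), mul_smul_comm,
        ← mul_assoc _ (gen q .a),
        pow_mul_of_qcommute (h.ba hq), smul_mul_assoc, smul_smul, mul_smul_comm]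
      simp only [mul_assoc]
    have hd (y : SL q) (j k : ℕ) : y * (gen q .b ^ j * gen q .c ^ k) * gen q .d =
        (q⁻¹ ^ k * q⁻¹ ^ j) • (y * gen q .d * (gen q .b ^ j * gen q .c ^ k)) := by
      rw [mul_assoc, mul_assoc, pow_mul_of_qcommute h.cd, mul_smul_comm, ← mul_assoc _ (gen q .d),
        pow_mul_of_qcommute h.bd, smul_mul_assoc, smul_smul, mul_smul_comm]
      simp only [mul_assoc]
    have had : gen q .a * gen q .d = 1 + q⁻¹ • (gen q .b * gen q .c) := by rw [← h.det]; abel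
    have hda : gen q .d * gen q .a = 1 + q • (gen q .b * gen q .c) := by rw [← h.det']; abel
    have hbcm (j k : ℕ) : gen q .b * gen q .c * (gen q .b ^ j * gen q .c ^ k) =
        gen q .b ^ (j + 1) * gen q .c ^ (k + 1) := by
      rw [mul_assoc, ← mul_assoc (gen q .c), (hbc.symm.pow_right j).eq, mul_assoc, ← mul_assoc,
        ← pow_succ', ← pow_succ']
    rcases hx with ⟨⟨i, j, k⟩, rfl⟩ | ⟨⟨i, j, k⟩, rfl⟩ <;> cases g <;> simp only [hb, hc, ha, hd]
    · rw [← pow_succ]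
      exact Submodule.smul_mem _ _ (a_monomial_mem _ _ _)
    · exact a_monomial_mem _ _ _
    · exact a_monomial_mem _ _ _
    · refine Submodule.smul_mem _ _ ?_
      cases i with
      | zero => simpa using d_monomial_mem (q := q) 1 j k
      | succ i =>
        rw [pow_succ, mul_assoc (gen q .a ^ i), had, mul_assoc, add_mul, one_mul, smul_mul_assoc,
          hbcm, mul_add, mul_smul_comm]
        exact add_mem (a_monomial_mem _ _ _) (Submodule.smul_mem _ _ (a_monomial_mem _ _ _))
    · refine Submodule.smul_mem _ _ ?_
      cases i with
      | zero => simpa using a_monomial_mem (q := q) 1 j k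
      | succ i =>
        rw [pow_succ, mul_assoc (gen q .d ^ i), hda, mul_assoc, add_mul, one_mul, smul_mul_assoc,
          hbcm, mul_add, mul_smul_comm]
        exact add_mem (d_monomial_mem _ _ _) (Submodule.smul_mem _ _ (d_monomial_mem _ _ _))
    · exact d_monomial_mem _ _ _
    · exact d_monomial_mem _ _ _
    · rw [← pow_succ]
      exact Submodule.smul_mem _ _ (d_monomial_mem _ _ _)

theorem span_monomials (hq : q ≠ 0) : Submodule.span ℂ (monomials q) = ⊤ := by
  have key (f : FreeAlgebra ℂ Gen) : ∀ s ∈ Submodule.span ℂ (monomials q),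
      s * proj q f ∈ Submodule.span ℂ (monomials q) := by
    induction f using FreeAlgebra.induction with
    | grade0 r =>
      intro s hs
      rw [AlgHom.commutes, ← Algebra.commutes, ← Algebra.smul_def]
      exact Submodule.smul_mem _ _ hs
    | grade1 g => exact fun s hs => span_monomials_mul_gen hq hs g
    | mul f g hf hg =>
      intro s hs
      rw [map_mul, ← mul_assoc]
      exact hg _ (hf _ hs)
    | add f g hf hg =>
      intro s hs
      rw [map_add, mul_add]
      exact add_mem (hf _ hs) (hg _ hs)
  refine eq_top_iff.2 fun x _ => ?_
  obtain ⟨f, rfl⟩ := RingQuot.mkAlgHom_surjective ℂ (Rel q) x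
  have := key f 1 (by simpa using a_monomial_mem (q := q) 0 0 0)
  rwa [one_mul] at this

/-- The projection of `A(SL_q(2))` onto its part of degree `0`. -/
def degZero (hq : q ≠ 0) : SL q →ₗ[ℂ] SL q :=
  (TensorProduct.rid ℂ (SL q)).toLinearMap ∘ₗ
    (LinearMap.lTensor (SL q) (Finsupp.lapply (R := ℂ) (0 : ℤ) ∘ₗ
      (AddMonoidAlgebra.coeffLinearEquiv ℂ).toLinearMap)) ∘ₗ (coaction q hq).toLinearMap

theorem HasDeg.degZero_eq {hq : q ≠ 0} {p : SL q} {i : ℤ} (hp : HasDeg hq p i) :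
    degZero hq p = if i = 0 then p else 0 := by
  unfold HasDeg at hp
  simp only [degZero, LinearMap.comp_apply, AlgHom.toLinearMap_apply, hp]
  have h0 : (LaurentPolynomial.T i : ℂ[T;T⁻¹]).coeff 0 = if i = 0 then 1 else 0 :=
    LaurentPolynomial.T_apply 0 i
  simp [h0]

end QSphere

namespace QSphere

variable {q : ℂ}

/-! ### The element `ζ` and its commutation relations -/

/-- The element `ζ = -q⁻¹ bc` attached to four elements `a, b, c, d` of an algebra. -/
def zetaOf (q : ℂ) {B : Type} [Ring B] [Algebra ℂ B] (x : Gen → B) : B :=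
  (-q⁻¹) • (x .b * x .c)

theorem mul_eq_smul_zetaOf {B : Type} [Ring B] [Algebra ℂ B] (x : Gen → B) (hq : q ≠ 0) :
    x .b * x .c = (-q) • zetaOf q x := by
  rw [zetaOf, smul_smul, neg_mul_neg, mul_inv_cancel₀ hq, one_smul]

namespace IsRep

variable {B : Type} [Ring B] [Algebra ℂ B] {x : Gen → B} (h : IsRep q x)
include h

theorem ad_eq : x .a * x .d = 1 - zetaOf q x := by
  rw [← h.det, zetaOf]
  module

theorem da_eq : x .d * x .a = 1 - q ^ 2 • zetaOf q x := by
  rw [← h.det', zetaOf, smul_smul]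
  match_scalars <;> field_simp
  norm_num

theorem zeta_mul_a (hq : q ≠ 0) : zetaOf q x * x .a = q ^ 2 • (x .a * zetaOf q x) := by
  rw [zetaOf, smul_mul_assoc, mul_assoc, h.ca hq, mul_smul_comm, ← mul_assoc, h.ba hq,
    smul_mul_assoc, mul_smul_comm, mul_assoc, smul_smul, smul_smul, smul_smul]
  ring_nf

theorem zeta_mul_d : zetaOf q x * x .d = (q⁻¹) ^ 2 • (x .d * zetaOf q x) := by
  rw [zetaOf, smul_mul_assoc, mul_assoc, h.cd, mul_smul_comm, ← mul_assoc, h.bd,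
    smul_mul_assoc, mul_smul_comm, mul_assoc, smul_smul, smul_smul, smul_smul]
  ring_nf

theorem zeta_mul_b : zetaOf q x * x .b = x .b * zetaOf q x := by
  rw [zetaOf, smul_mul_assoc, mul_smul_comm, mul_assoc, h.bc]

theorem zeta_mul_c : zetaOf q x * x .c = x .c * zetaOf q x := by
  rw [zetaOf, smul_mul_assoc, mul_smul_comm, ← mul_assoc, h.bc]

theorem zeta_mul_ab (hq : q ≠ 0) :
    zetaOf q x * (x .a * x .b) = q ^ 2 • (x .a * x .b * zetaOf q x) := by
  rw [← mul_assoc, h.zeta_mul_a hq, smul_mul_assoc, mul_assoc, h.zeta_mul_b, mul_assoc]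

theorem zeta_mul_cd : zetaOf q x * (x .c * x .d) = (q⁻¹) ^ 2 • (x .c * x .d * zetaOf q x) := by
  rw [← mul_assoc, h.zeta_mul_c, mul_assoc, h.zeta_mul_d, mul_smul_comm, mul_assoc]

theorem ab_mul_cd (hq : q ≠ 0) :
    x .a * x .b * (x .c * x .d) = (-q⁻¹) • (zetaOf q x - zetaOf q x ^ 2) := by
  have h1 : x .b * x .c * x .d = (q⁻¹) ^ 2 • (x .d * (x .b * x .c)) := by
    rw [mul_assoc, h.cd, mul_smul_comm, ← mul_assoc, h.bd, smul_mul_assoc, smul_smul, mul_assoc,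
      pow_two]
  rw [mul_assoc, ← mul_assoc (x .b), h1, mul_smul_comm, ← mul_assoc, h.ad_eq,
    mul_eq_smul_zetaOf x hq,
    mul_smul_comm, sub_mul, one_mul, pow_two (zetaOf q x), smul_smul]
  congr 1
  field_simp

theorem cd_mul_ab (hq : q ≠ 0) :
    x .c * x .d * (x .a * x .b) = (-q) • (zetaOf q x - q ^ 2 • zetaOf q x ^ 2) := by
  rw [mul_assoc, ← mul_assoc (x .d), h.da_eq, sub_mul, one_mul, smul_mul_assoc, h.zeta_mul_b,
    mul_sub, mul_smul_comm, ← mul_assoc, ← h.bc, mul_eq_smul_zetaOf x hq, smul_mul_assoc,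
    pow_two (zetaOf q x)]
  module

end IsRep

/-! ### A spanning set of `A(S_q²)` -/

/-- The elements `(ab)ᵐ ζⁿ` and `(cd)ᵐ ζⁿ` of `A(S_q²)`. -/
def sphereMonomials (hq : q ≠ 0) : Set (sphere q hq) :=
  (Set.range fun i : ℕ × ℕ => elemAB hq ^ i.1 * elemZeta hq ^ i.2) ∪
  (Set.range fun i : ℕ × ℕ => elemCD hq ^ i.1 * elemZeta hq ^ i.2)

theorem hasDeg_monomial_a (hq : q ≠ 0) (i j k : ℕ) :
    HasDeg hq (gen q .a ^ i * (gen q .b ^ j * gen q .c ^ k)) (i + (k - j)) := by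
  convert ((hasDeg_a hq).pow i).mul (((hasDeg_b hq).pow j).mul ((hasDeg_c hq).pow k)) using 1
  ring

theorem hasDeg_monomial_d (hq : q ≠ 0) (i j k : ℕ) :
    HasDeg hq (gen q .d ^ i * (gen q .b ^ j * gen q .c ^ k)) (-i + (k - j)) := by
  convert ((hasDeg_d hq).pow i).mul (((hasDeg_b hq).pow j).mul ((hasDeg_c hq).pow k)) using 1
  ring

theorem coe_elemZeta (hq : q ≠ 0) : (elemZeta hq : SL q) = zetaOf q (gen q) := rfl

theorem b_pow_mul_c_pow (hq : q ≠ 0) (k : ℕ) :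
    gen q .b ^ k * gen q .c ^ k = (-q) ^ k • (elemZeta hq : SL q) ^ k := by
  have hbc : Commute (gen q .b) (gen q .c) := (isRep_gen q).bc
  rw [← hbc.mul_pow, mul_eq_smul_zetaOf _ hq, smul_pow, coe_elemZeta]

theorem degZero_mem (hq : q ≠ 0) (p : SL q) : degZero hq p ∈
    (Submodule.span ℂ (sphereMonomials hq)).map (sphere q hq).val.toLinearMap := by
  have h := isRep_gen q
  have hp : p ∈ Submodule.span ℂ (monomials q) := by rw [span_monomials hq]; trivial
  induction hp using Submodule.span_induction with
  | zero => simp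
  | add x y _ _ hx hy => rw [map_add]; exact add_mem hx hy
  | smul t x _ hx => rw [map_smul]; exact Submodule.smul_mem _ _ hx
  | mem x hx =>
    rcases hx with ⟨⟨i, j, k⟩, rfl⟩ | ⟨⟨i, j, k⟩, rfl⟩
    · simp only [(hasDeg_monomial_a hq i j k).degZero_eq]
      split_ifs with h0
      · obtain rfl : j = i + k := by omega
        obtain ⟨s, hs⟩ := exists_pow_mul_pow_eq_smul (y := gen q .a) (x := gen q .b) h.ab i
        have h1 : gen q .b * gen q .a = q • (elemAB hq : SL q) := h.ba hq
        have h2 : gen q .a ^ i * (gen q .b ^ (i + k) * gen q .c ^ k) =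
            (s * q ^ i * (-q) ^ k) • ((elemAB hq ^ i * elemZeta hq ^ k : sphere q hq) : SL q) := by
          rw [pow_add, mul_assoc (gen q .b ^ i), ← mul_assoc, hs, b_pow_mul_c_pow hq, h1,
            smul_pow, smul_mul_assoc, smul_mul_assoc, mul_smul_comm, smul_smul, smul_smul]
          rfl
        rw [h2]
        exact Submodule.smul_mem _ _
          ⟨_, Submodule.subset_span (Or.inl ⟨(i, k), rfl⟩), rfl⟩
      · exact zero_mem _
    · simp only [(hasDeg_monomial_d hq i j k).degZero_eq]
      split_ifs with h0
      · obtain rfl : k = i + j := by omega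
        obtain ⟨s, hs⟩ := exists_pow_mul_pow_eq_smul (y := gen q .d) (x := gen q .c) (h.dc hq) i
        have hbc : Commute (gen q .b) (gen q .c) := h.bc
        have h2 : gen q .d ^ i * (gen q .b ^ j * gen q .c ^ (i + j)) =
            (s * (-q) ^ j) • ((elemCD hq ^ i * elemZeta hq ^ j : sphere q hq) : SL q) := by
          rw [(hbc.pow_pow _ _).eq, pow_add, mul_assoc (gen q .c ^ i), ← (hbc.pow_pow _ _).eq,
            ← mul_assoc, hs, b_pow_mul_c_pow hq, smul_mul_assoc, mul_smul_comm, smul_smul]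
          rfl
        rw [h2]
        exact Submodule.smul_mem _ _
          ⟨_, Submodule.subset_span (Or.inr ⟨(i, j), rfl⟩), rfl⟩
      · exact zero_mem _

/-- A coinvariant is its own degree-zero part, so `degZero_mem` applies to it directly. -/
theorem span_sphereMonomials (hq : q ≠ 0) : Submodule.span ℂ (sphereMonomials hq) = ⊤ := by
  refine eq_top_iff.2 fun p _ => ?_
  have h1 : HasDeg hq (p : SL q) 0 := by
    have := (mem_sphere hq _).1 p.2
    rwa [← LaurentPolynomial.T_zero] at this
  have h2 := degZero_mem hq (p : SL q)
  rw [h1.degZero_eq, if_pos rfl] at h2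
  obtain ⟨r, hr, hrp⟩ := h2
  rwa [← Subtype.ext (a1 := r) (a2 := p) hrp]

theorem adjoin_sphere (hq : q ≠ 0) :
    Algebra.adjoin ℂ {elemAB hq, elemCD hq, elemZeta hq} = ⊤ := by
  refine eq_top_iff.2 fun p _ => ?_
  have hp : p ∈ Submodule.span ℂ (sphereMonomials hq) := by rw [span_sphereMonomials]; trivial
  have hle : Submodule.span ℂ (sphereMonomials hq) ≤
      Subalgebra.toSubmodule (Algebra.adjoin ℂ {elemAB hq, elemCD hq, elemZeta hq}) := by
    refine Submodule.span_le.2 ?_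
    have h (y) (hy : y ∈ ({elemAB hq, elemCD hq, elemZeta hq} : Set (sphere q hq))) :
        y ∈ Algebra.adjoin ℂ {elemAB hq, elemCD hq, elemZeta hq} := Algebra.subset_adjoin hy
    rintro _ (⟨⟨i, j⟩, rfl⟩ | ⟨⟨i, j⟩, rfl⟩)
    · exact Subalgebra.mul_mem _ (pow_mem (h _ (by simp)) _) (pow_mem (h _ (by simp)) _)
    · exact Subalgebra.mul_mem _ (pow_mem (h _ (by simp)) _) (pow_mem (h _ (by simp)) _)
  exact hle hp

/-! ### The Chern trace -/

theorem IsChernTrace.ext {hq : q ≠ 0} {τ τ' : sphere q hq →ₗ[ℂ] ℂ} (h : IsChernTrace hq τ)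
    (h' : IsChernTrace hq τ') : τ = τ' := by
  refine LinearMap.ext_on (span_sphereMonomials hq) ?_
  rintro _ (⟨⟨i, j⟩, rfl⟩ | ⟨⟨i, j⟩, rfl⟩)
  · exact (h i j).1.trans (h' i j).1.symm
  · exact (h i j).2.trans (h' i j).2.symm

section Commutation

variable (hq : q ≠ 0)

theorem elemZeta_mul_elemAB :
    elemZeta hq * elemAB hq = q ^ 2 • (elemAB hq * elemZeta hq) :=
  Subtype.ext ((isRep_gen q).zeta_mul_ab hq)

theorem elemZeta_mul_elemCD :
    elemZeta hq * elemCD hq = (q⁻¹) ^ 2 • (elemCD hq * elemZeta hq) :=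
  Subtype.ext ((isRep_gen q).zeta_mul_cd)

theorem elemAB_mul_elemCD :
    elemAB hq * elemCD hq = (-q⁻¹) • (elemZeta hq - elemZeta hq ^ 2) :=
  Subtype.ext ((isRep_gen q).ab_mul_cd hq)

theorem elemCD_mul_elemAB :
    elemCD hq * elemAB hq = (-q) • (elemZeta hq - q ^ 2 • elemZeta hq ^ 2) :=
  Subtype.ext ((isRep_gen q).cd_mul_ab hq)

end Commutation

/-- A linear functional that commutes with generators is a trace. -/
theorem isTrace_of_adjoin_eq_top {R : Type} [Ring R] [Algebra ℂ R] {s : Set R}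
    (hs : Algebra.adjoin ℂ s = ⊤) {τ : R →ₗ[ℂ] ℂ} (h : ∀ x ∈ s, ∀ y, τ (x * y) = τ (y * x)) :
    AlgK0.IsTrace τ := by
  intro x
  have hx : x ∈ Algebra.adjoin ℂ s := by rw [hs]; trivial
  induction hx using Algebra.adjoin_induction with
  | mem x hx => exact h x hx
  | algebraMap r => intro y; rw [Algebra.commutes]
  | add x y _ _ hx hy => intro z; rw [add_mul, mul_add, map_add, map_add, hx, hy]
  | mul x y _ _ hx hy => intro z; rw [mul_assoc, hx, mul_assoc, hy, mul_assoc]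

section TraceOnMonomials

variable {R : Type} [Ring R] [Algebra ℂ R] {u v z : R} {s : ℂ} {τ : R →ₗ[ℂ] ℂ}

theorem apply_mul_comm_of_qcommute (hzu : z * u = s • (u * z))
    (hτ : ∀ m n, τ (u ^ (m + 1) * z ^ n) = 0) (m n : ℕ) :
    τ (z * (u ^ m * z ^ n)) = τ (u ^ m * z ^ n * z) := by
  rw [← mul_assoc, mul_pow_of_qcommute hzu, smul_mul_assoc, mul_assoc, mul_assoc, ← pow_succ',
    ← pow_succ, map_smul]
  rcases m with _ | m
  · simp
  · rw [hτ, smul_zero]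

theorem apply_mul_comm_of_shift (hzu : z * u = s • (u * z))
    (hτ : ∀ m n, τ (u ^ (m + 1) * z ^ n) = 0) (m n : ℕ) :
    τ (u * (u ^ m * z ^ n)) = τ (u ^ m * z ^ n * u) := by
  rw [← mul_assoc, ← pow_succ', hτ, mul_assoc, pow_mul_of_qcommute hzu, mul_smul_comm,
    ← mul_assoc, ← pow_succ, map_smul, hτ, smul_zero]

/-- Both products are `uᵐ` times a polynomial in `z`, so `τ` kills them unless `m = 0`; for `m = 0`
equality of the values is exactly the recursion `hα`. When `α = α'` it says that `τ(zⁿ)(sⁿ - 1)` is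
independent of `n > 0`, which the values `(1 - q²ⁿ)⁻¹` with `s = q²` achieve. -/
theorem apply_mul_comm_of_opposite_shift {α α' : ℂ} (hs : s ≠ 0) (hzu : z * u = s • (u * z))
    (hzv : z * v = s⁻¹ • (v * z)) (huv : u * v = α • z - α' • z ^ 2)
    (hvu : v * u = (α * s) • z - (α' * s ^ 2) • z ^ 2)
    (hτ : ∀ m n, τ (u ^ (m + 1) * z ^ n) = 0)
    (hα : ∀ n, α * τ (z ^ (n + 1)) * (s ^ (n + 1) - 1) =
      α' * τ (z ^ (n + 1 + 1)) * (s ^ (n + 1 + 1) - 1)) (m n : ℕ) :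
    τ (v * (u ^ (m + 1) * z ^ n)) = τ (u ^ (m + 1) * z ^ n * v) := by
  have h1 : v * (u ^ (m + 1) * z ^ n) = (α * s * s ^ m) • (u ^ m * z ^ (n + 1)) -
      (α' * s ^ 2 * s ^ (2 * m)) • (u ^ m * z ^ (n + 1 + 1)) := by
    rw [pow_succ', ← mul_assoc, ← mul_assoc, hvu, sub_mul, smul_mul_assoc, smul_mul_assoc,
      pow_mul_pow_of_qcommute hzu, mul_pow_of_qcommute hzu, sub_mul, smul_smul, smul_smul,
      smul_mul_assoc, smul_mul_assoc, mul_assoc (u ^ m), mul_assoc (u ^ m), ← pow_succ' z,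
      ← pow_add z, add_comm 2 n]
  have h2 : u ^ (m + 1) * z ^ n * v = (s⁻¹ ^ n * α) • (u ^ m * z ^ (n + 1)) -
      (s⁻¹ ^ n * α') • (u ^ m * z ^ (n + 1 + 1)) := by
    rw [mul_assoc, pow_mul_of_qcommute hzv, mul_smul_comm, ← mul_assoc, pow_succ, mul_assoc (u ^ m),
      huv, mul_assoc, sub_mul, smul_mul_assoc, smul_mul_assoc, ← pow_succ' z, ← pow_add z, mul_sub,
      mul_smul_comm, mul_smul_comm, smul_sub, smul_smul, smul_smul, add_comm 2 n]
  rw [h1, h2]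
  rcases m with _ | m
  · have h3 := hα n
    have h4 : s⁻¹ ^ n * s ^ n = 1 := by rw [← mul_pow, inv_mul_cancel₀ hs, one_pow]
    simp only [pow_zero, one_mul, mul_one, mul_zero, map_sub, map_smul, smul_eq_mul]
    linear_combination s⁻¹ ^ n * h3 - (α * s * τ (z ^ (n + 1)) -
      α' * s ^ 2 * τ (z ^ (n + 1 + 1))) * h4
  · simp only [map_sub, map_smul, hτ, smul_zero]

end TraceOnMonomials

variable {hq : q ≠ 0}

namespace IsChernTrace

variable {τ : sphere q hq →ₗ[ℂ] ℂ} (h : IsChernTrace hq τ)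
include h

theorem apply_zeta_pow (n : ℕ) : τ (elemZeta hq ^ n) = (1 - q ^ (2 * n))⁻¹ := by
  have := (h 0 n).1
  rw [pow_zero, one_mul] at this
  rw [this]
  rcases Nat.eq_zero_or_pos n with rfl | hn
  · simp
  · simp [hn]

theorem apply_ab_pow_succ (m n : ℕ) : τ (elemAB hq ^ (m + 1) * elemZeta hq ^ n) = 0 := by
  rw [(h _ _).1, if_neg (by simp)]

theorem apply_cd_pow_succ (m n : ℕ) : τ (elemCD hq ^ (m + 1) * elemZeta hq ^ n) = 0 := by
  rw [(h _ _).2, if_neg (by simp)]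

theorem isTrace (hroot : ∀ n : ℕ, 0 < n → q ^ n ≠ 1) : AlgK0.IsTrace τ := by
  have hQ : q ^ 2 ≠ 0 := pow_ne_zero 2 hq
  have hw (n : ℕ) : (1 - q ^ (2 * (n + 1))) * (1 - q ^ (2 * (n + 1)))⁻¹ = 1 :=
    mul_inv_cancel₀ (sub_ne_zero.2 (hroot _ (by omega)).symm)
  have hzu := elemZeta_mul_elemAB hq
  have hzv := elemZeta_mul_elemCD hq
  refine isTrace_of_adjoin_eq_top (adjoin_sphere hq) fun x hx y => ?_
  suffices hlin : τ ∘ₗ LinearMap.mulLeft ℂ x = τ ∘ₗ LinearMap.mulRight ℂ x from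
    LinearMap.congr_fun hlin y
  refine LinearMap.ext_on (span_sphereMonomials hq) ?_
  rintro _ (⟨⟨m, n⟩, rfl⟩ | ⟨⟨m, n⟩, rfl⟩) <;>
  simp only [LinearMap.comp_apply, LinearMap.mulLeft_apply, LinearMap.mulRight_apply] <;>
  rcases hx with rfl | rfl | rfl
  · exact apply_mul_comm_of_shift hzu h.apply_ab_pow_succ m n
  · rcases m with _ | m
    -- For `m = 0` the monomial is `ζⁿ`, which also belongs to the `cd` family.
    · simpa using apply_mul_comm_of_shift hzv h.apply_cd_pow_succ 0 n
    -- The coefficients are read off from `ab · cd = -q⁻¹ζ + q⁻¹ζ²`.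
    · refine apply_mul_comm_of_opposite_shift (α := -q⁻¹) (α' := -q⁻¹) hQ hzu (by rw [hzv, inv_pow])
        ?_ ?_ h.apply_ab_pow_succ (fun k => ?_) m n
      · rw [elemAB_mul_elemCD, smul_sub]
      · rw [elemCD_mul_elemAB, smul_sub, smul_smul]
        match_scalars <;> field_simp
      · simp only [h.apply_zeta_pow, ← pow_mul]
        linear_combination q⁻¹ * hw k - q⁻¹ * hw (k + 1)
  · exact apply_mul_comm_of_qcommute hzu h.apply_ab_pow_succ m n
  · rcases m with _ | m
    · simpa using apply_mul_comm_of_shift hzu h.apply_ab_pow_succ 0 n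
    -- The roles of `ab` and `cd` are exchanged, so `s` becomes `q⁻²`, and the coefficients come
    -- from `cd · ab = -qζ + q³ζ²`.
    · refine apply_mul_comm_of_opposite_shift (α := -q) (α' := -q ^ 3) (inv_ne_zero hQ)
        (by rw [hzv, inv_pow]) (by rw [hzu, inv_inv]) ?_ ?_ h.apply_cd_pow_succ (fun k => ?_) m n
      · rw [elemCD_mul_elemAB, smul_sub, smul_smul]
        match_scalars <;> ring
      · rw [elemAB_mul_elemCD, smul_sub]
        match_scalars <;> field_simp
      · simp only [h.apply_zeta_pow]
        have h1 := hw k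
        have h2 := hw (k + 1)
        have e1 : (q ^ 2)⁻¹ ^ (k + 1) = (q ^ (2 * (k + 1)))⁻¹ := by rw [inv_pow, pow_mul]
        have e2 : (q ^ 2)⁻¹ ^ (k + 1 + 1) = (q ^ (2 * (k + 1 + 1)))⁻¹ := by rw [inv_pow, pow_mul]
        have e3 : ((q ^ (2 * (k + 1)))⁻¹ - 1) * (1 - q ^ (2 * (k + 1)))⁻¹ =
            (q ^ (2 * (k + 1)))⁻¹ := by
          have : q ^ (2 * (k + 1)) ≠ 0 := pow_ne_zero _ hq
          calc _ = (q ^ (2 * (k + 1)))⁻¹ *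
              ((1 - q ^ (2 * (k + 1))) * (1 - q ^ (2 * (k + 1)))⁻¹) := by field_simp
            _ = _ := by rw [h1, mul_one]
        have e4 : ((q ^ (2 * (k + 1 + 1)))⁻¹ - 1) * (1 - q ^ (2 * (k + 1 + 1)))⁻¹ =
            (q ^ (2 * (k + 1 + 1)))⁻¹ := by
          have : q ^ (2 * (k + 1 + 1)) ≠ 0 := pow_ne_zero _ hq
          calc _ = (q ^ (2 * (k + 1 + 1)))⁻¹ *
              ((1 - q ^ (2 * (k + 1 + 1))) * (1 - q ^ (2 * (k + 1 + 1)))⁻¹) := by field_simp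
            _ = _ := by rw [h2, mul_one]
        rw [e1, e2, mul_assoc, mul_assoc, mul_comm _ ((q ^ (2 * (k + 1)))⁻¹ - 1),
          mul_comm _ ((q ^ (2 * (k + 1 + 1)))⁻¹ - 1), e3, e4]
        field_simp
        ring
  · exact apply_mul_comm_of_shift hzv h.apply_cd_pow_succ m n
  · exact apply_mul_comm_of_qcommute hzv h.apply_cd_pow_succ m n

end IsChernTrace

end QSphere

namespace QSphere

variable {q : ℂ}

open Polynomial

/-! ### Existence of the Chern trace -/

/-- The substitution `X ↦ s X`. -/
def dilate (s : ℂ) : ℂ[X] →ₐ[ℂ] ℂ[X] := aeval (C s * X)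

@[simp] theorem dilate_X (s : ℂ) : dilate s X = C s * X := by simp [dilate]

@[simp] theorem dilate_C (s t : ℂ) : dilate s (C t) = C t := by simp [dilate]

theorem dilate_dilate {s t : ℂ} (h : s * t = 1) (p : ℂ[X]) : dilate s (dilate t p) = p := by
  suffices hc : (dilate s).comp (dilate t) = AlgHom.id ℂ _ from AlgHom.congr_fun hc p
  ext1
  simp [← mul_assoc, ← C_mul, mul_comm t, h]

theorem eval_dilate (s t : ℂ) (p : ℂ[X]) : (dilate s p).eval t = p.eval (s * t) := by
  rw [dilate, ← comp_eq_aeval, eval_comp]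
  simp

/-- The action of the generators of `A(SL_q(2))` on the functions `f : ℤ → ℂ[X]`, thought of as
`∑ fₘ(X) sᵐ` with `s X = q⁻¹ X s`: here `a` acts as `s`, and `b`, `c` act as `-q X`, `X`. -/
def bilateralGen (q : ℂ) : Gen → Module.End ℂ (ℤ → ℂ[X])
  | .a => LinearMap.pi fun m => (dilate q⁻¹).toLinearMap ∘ₗ LinearMap.proj (m - 1)
  | .b => LinearMap.pi fun m => LinearMap.mulLeft ℂ (-C q * X) ∘ₗ LinearMap.proj m
  | .c => LinearMap.pi fun m => LinearMap.mulLeft ℂ X ∘ₗ LinearMap.proj m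
  | .d => LinearMap.pi fun m => LinearMap.mulLeft ℂ (1 - C q ^ 2 * X ^ 2) ∘ₗ
      (dilate q).toLinearMap ∘ₗ LinearMap.proj (m + 1)

theorem isRep_bilateralGen (hq : q ≠ 0) : IsRep q (bilateralGen q) := by
  have h1 : C q * C q⁻¹ = (1 : ℂ[X]) := by rw [← C_mul, mul_inv_cancel₀ hq, C_1]
  have h2 (p : ℂ[X]) : dilate q (dilate q⁻¹ p) = p := dilate_dilate (mul_inv_cancel₀ hq) p
  have h3 (p : ℂ[X]) : dilate q⁻¹ (dilate q p) = p := dilate_dilate (inv_mul_cancel₀ hq) p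
  constructor <;> refine LinearMap.ext fun f => funext fun m => ?_ <;>
    simp only [bilateralGen, Module.End.mul_apply, LinearMap.pi_apply, LinearMap.comp_apply,
      LinearMap.proj_apply, LinearMap.mulLeft_apply, LinearMap.smul_apply, Pi.smul_apply,
      AlgHom.toLinearMap_apply, map_mul, map_neg, map_sub, map_one, map_pow, dilate_X, dilate_C,
      LinearMap.sub_apply, Pi.sub_apply, Module.End.one_apply, smul_eq_C_mul, h2, h3,
      sub_add_cancel, add_sub_cancel_right]
  · ring
  · ring
  · linear_combination (C q * X * (1 - C q ^ 2 * X ^ 2) * dilate q (f (m + 1))) * h1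
  · ring
  · linear_combination (-X * (1 - C q ^ 2 * X ^ 2) * dilate q (f (m + 1))) * h1
  · linear_combination (-X ^ 2 * f m * (C q * C q⁻¹)) * h1
  · linear_combination (-X ^ 2 * f m * (C q * C q⁻¹)) * h1
  · ring

/-- The action of `A(SL_q(2))` on functions `ℤ → ℂ[X]`. -/
def bilateralRep (hq : q ≠ 0) : SL q →ₐ[ℂ] Module.End ℂ (ℤ → ℂ[X]) :=
  lift q (bilateralGen q) (isRep_bilateralGen hq)

/-- The linear functional `Xⁿ ↦ (1 - qⁿ)⁻¹` for `n > 0` and `1 ↦ 0`. -/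
def regularizedSum (q : ℂ) : ℂ[X] →ₗ[ℂ] ℂ := lsum fun n => (1 - q ^ n)⁻¹ • LinearMap.id

/-- The functional `τ¹`. -/
def chernTrace (hq : q ≠ 0) : sphere q hq →ₗ[ℂ] ℂ :=
  regularizedSum q ∘ₗ LinearMap.proj 0 ∘ₗ LinearMap.applyₗ (Pi.single 0 1) ∘ₗ
    (bilateralRep hq).toLinearMap ∘ₗ (sphere q hq).val.toLinearMap

/-- `ab` raises and `cd` lowers the power of `s` by one, so their positive powers move the series
`1` off index `0` and contribute nothing there. Multiplication by `X²ⁿ` is all that `ζⁿ` does, and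
`regularizedSum` assigns it the required value. -/
theorem isChernTrace_chernTrace (hq : q ≠ 0) : IsChernTrace hq (chernTrace hq) := by
  have hz (f : ℤ → ℂ[X]) : bilateralRep hq (elemZeta hq : SL q) f = fun m => X ^ 2 * f m := by
    have h1 : C q * C q⁻¹ = (1 : ℂ[X]) := by rw [← C_mul, mul_inv_cancel₀ hq, C_1]
    funext m
    simp [coe_elemZeta, zetaOf, bilateralRep, bilateralGen, smul_eq_C_mul]
    linear_combination (X ^ 2 * f m) * h1
  have hzn (n : ℕ) (f : ℤ → ℂ[X]) :
      bilateralRep hq ((elemZeta hq : SL q) ^ n) f = fun m => X ^ (2 * n) * f m := by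
    induction n with
    | zero => simp
    | succ n ih =>
      rw [pow_succ', map_mul, Module.End.mul_apply, ih, hz]
      funext m
      ring
  have hu (m : ℕ) (f : ℤ → ℂ[X]) (hf : ∀ k, 0 < k → f (-k) = 0) (k : ℤ) (hk : 0 < k) :
      bilateralRep hq ((elemAB hq : SL q) ^ m) f (m - k) = 0 := by
    induction m generalizing k with
    | zero => simpa using hf k hk
    | succ m ih =>
      rw [pow_succ', map_mul, Module.End.mul_apply]
      have h1 : ((m + 1 : ℕ) : ℤ) - k - 1 = m - k := by push_cast; ring
      have h2 := ih k hk
      generalize bilateralRep hq ((elemAB hq : SL q) ^ m) f = g at h2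
      simp only [elemAB, bilateralRep, map_mul, lift_gen, Module.End.mul_apply, bilateralGen,
        LinearMap.pi_apply, LinearMap.comp_apply, LinearMap.proj_apply, h1]
      simp [h2]
  have hv (m : ℕ) (f : ℤ → ℂ[X]) (hf : ∀ k, 0 < k → f k = 0) (k : ℤ) (hk : 0 < k) :
      bilateralRep hq ((elemCD hq : SL q) ^ m) f (k - m) = 0 := by
    induction m generalizing k with
    | zero => simpa using hf k hk
    | succ m ih =>
      rw [pow_succ', map_mul, Module.End.mul_apply]
      have h1 : k - ((m + 1 : ℕ) : ℤ) + 1 = k - m := by push_cast; ring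
      have h2 := ih k hk
      generalize bilateralRep hq ((elemCD hq : SL q) ^ m) f = g at h2
      simp only [elemCD, bilateralRep, map_mul, lift_gen, Module.End.mul_apply, bilateralGen,
        LinearMap.pi_apply, LinearMap.comp_apply, LinearMap.proj_apply, h1]
      simp [h2]
  have hone (k : ℤ) (hk : k ≠ 0) : (Pi.single 0 1 : ℤ → ℂ[X]) k = 0 := Pi.single_eq_of_ne hk 1
  have hval (y : sphere q hq) (n : ℕ) : chernTrace hq (y * elemZeta hq ^ n) = regularizedSum q
      (bilateralRep hq (y : SL q) (fun m => X ^ (2 * n) * (Pi.single 0 1 : ℤ → ℂ[X]) m) 0) := by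
    rw [← hzn]
    simp [chernTrace]
  have hreg (n : ℕ) : regularizedSum q (X ^ (2 * n)) = (1 - q ^ (2 * n))⁻¹ := by
    simp [regularizedSum, lsum_apply, X_pow_eq_monomial, sum_monomial_index]
  intro m n
  rcases m with _ | m
  · have h0 : chernTrace hq (elemZeta hq ^ n) = if 0 < n ∧ 0 = 0 then (1 - q ^ (2 * n))⁻¹ else 0 := by
      have := hval 1 n
      rw [one_mul] at this
      rw [this]
      rcases Nat.eq_zero_or_pos n with rfl | hn
      -- At `n = 0` the convention `0⁻¹ = 0` gives the prescribed value `0`.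
      · have := hreg 0
        simpa using this
      · simp [hreg, hn]
    simpa using h0
  · constructor
    · rw [hval, if_neg (by simp)]
      have := hu (m + 1) (fun m => X ^ (2 * n) * (Pi.single 0 1 : ℤ → ℂ[X]) m)
        (fun k hk => by rw [hone _ (by omega), mul_zero]) (m + 1) (by omega)
      rw [Nat.cast_add, Nat.cast_one, sub_self] at this
      rw [SubmonoidClass.coe_pow, this, map_zero]
    · rw [hval, if_neg (by simp)]
      have := hv (m + 1) (fun m => X ^ (2 * n) * (Pi.single 0 1 : ℤ → ℂ[X]) m)
        (fun k hk => by rw [hone _ (by omega), mul_zero]) (m + 1) (by omega)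
      rw [Nat.cast_add, Nat.cast_one, sub_self] at this
      rw [SubmonoidClass.coe_pow, this, map_zero]

end QSphere

namespace QSphere

variable {q : ℂ}

/-! ### Gaussian binomial coefficients -/

section QBinom

variable {t : ℂ} (ht : ∀ n : ℕ, 0 < n → t ^ n ≠ 1)

theorem qFactor_succ (t : ℂ) (n : ℕ) : qFactor t (n + 1) = qFactor t n * (t ^ (n + 1) - 1) :=
  Finset.prod_range_succ _ _

@[simp] theorem qFactor_zero (t : ℂ) : qFactor t 0 = 1 := rfl

include ht

theorem qFactor_ne_zero (n : ℕ) : qFactor t n ≠ 0 :=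
  Finset.prod_ne_zero_iff.2 fun i _ => sub_ne_zero.2 (ht _ i.succ_pos)

theorem qBinom_zero_right (n : ℕ) : qBinom t n 0 = 1 := by
  simp [qBinom, div_self (qFactor_ne_zero ht n)]

theorem qBinom_self (n : ℕ) : qBinom t n n = 1 := by
  simp [qBinom, div_self (qFactor_ne_zero ht n)]

/-- After cancelling common factors this is `tⁿ⁺¹ - 1 = (tⁿ⁻ᵏ - 1) + tⁿ⁻ᵏ(tᵏ⁺¹ - 1)`. The case `k =
n` is excluded because truncated subtraction makes `qBinom t n (n + 1)` equal to `1/(tⁿ⁺¹ - 1)`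
instead of `0`. -/
theorem qBinom_succ_succ {n k : ℕ} (hk : k < n) :
    qBinom t (n + 1) (k + 1) = qBinom t n (k + 1) + t ^ (n - k) * qBinom t n k := by
  obtain ⟨j, rfl⟩ := Nat.exists_eq_add_of_lt hk
  have e1 : k + j + 1 + 1 - (k + 1) = j + 1 := by omega
  have e2 : k + j + 1 - (k + 1) = j := by omega
  have e3 : k + j + 1 - k = j + 1 := by omega
  simp only [qBinom, e1, e2, e3]
  have h1 := qFactor_ne_zero ht k
  have h2 := qFactor_ne_zero ht j
  have h3 : t ^ (k + 1) - 1 ≠ 0 := sub_ne_zero.2 (ht _ k.succ_pos)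
  have h4 : t ^ (j + 1) - 1 ≠ 0 := sub_ne_zero.2 (ht _ j.succ_pos)
  rw [qFactor_succ t (k + j + 1), qFactor_succ t k, qFactor_succ t j]
  field_simp
  ring

theorem qBinom_succ_succ' {n k : ℕ} (hk : k < n) :
    qBinom t (n + 1) (k + 1) = t ^ (k + 1) * qBinom t n (k + 1) + qBinom t n k := by
  obtain ⟨j, rfl⟩ := Nat.exists_eq_add_of_lt hk
  have e1 : k + j + 1 + 1 - (k + 1) = j + 1 := by omega
  have e2 : k + j + 1 - (k + 1) = j := by omega
  have e3 : k + j + 1 - k = j + 1 := by omega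
  simp only [qBinom, e1, e2, e3]
  have h1 := qFactor_ne_zero ht k
  have h2 := qFactor_ne_zero ht j
  have h3 : t ^ (k + 1) - 1 ≠ 0 := sub_ne_zero.2 (ht _ k.succ_pos)
  have h4 : t ^ (j + 1) - 1 ≠ 0 := sub_ne_zero.2 (ht _ j.succ_pos)
  rw [qFactor_succ t (k + j + 1), qFactor_succ t k, qFactor_succ t j]
  field_simp
  ring

variable {M : Type*} [AddCommGroup M] [Module ℂ M]

/-- Pascal's rule in the form used by the inductions below: the terms `k` and `k + 1` of level `n +
1` are collected under the `k`-th coefficient of level `n`. The two end terms are split off, since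
`qBinom` does not vanish outside its range. -/
theorem sum_qBinom_succ_smul (n : ℕ) (f : ℕ → M) :
    ∑ k ∈ Finset.range (n + 2), qBinom t (n + 1) k • f k =
      ∑ k ∈ Finset.range (n + 1), qBinom t n k • (f k + t ^ (n - k) • f (k + 1)) := by
  rw [Finset.sum_range_succ, Finset.sum_range_succ', qBinom_zero_right ht, qBinom_self ht,
    Finset.sum_congr rfl fun k hk => by rw [qBinom_succ_succ ht (Finset.mem_range.1 hk)]]
  simp only [smul_add, Finset.sum_add_distrib, add_smul]
  rw [Finset.sum_range_succ' (fun k => qBinom t n k • f k), Finset.sum_range_succ (fun k =>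
    qBinom t n k • t ^ (n - k) • f (k + 1)), qBinom_zero_right ht, qBinom_self ht, Nat.sub_self,
    pow_zero]
  simp only [smul_smul, mul_comm (qBinom t n _), one_smul]
  abel

theorem sum_qBinom_succ_smul' (n : ℕ) (f : ℕ → M) :
    ∑ k ∈ Finset.range (n + 2), qBinom t (n + 1) k • f k =
      ∑ k ∈ Finset.range (n + 1), qBinom t n k • (t ^ k • f k + f (k + 1)) := by
  rw [Finset.sum_range_succ, Finset.sum_range_succ', qBinom_zero_right ht, qBinom_self ht,
    Finset.sum_congr rfl fun k hk => by rw [qBinom_succ_succ' ht (Finset.mem_range.1 hk)]]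
  simp only [smul_add, Finset.sum_add_distrib, add_smul]
  rw [Finset.sum_range_succ' (fun k => qBinom t n k • t ^ k • f k), Finset.sum_range_succ (fun k =>
    qBinom t n k • f (k + 1)), qBinom_zero_right ht, qBinom_self ht, pow_zero]
  simp only [smul_smul, mul_comm (qBinom t n _), one_smul]
  abel

end QBinom

/-! ### Partitions of unity -/

section Unity

variable {B : Type} [Ring B] [Algebra ℂ B] {x : Gen → B}

open Finset

/-- Under Pascal's rule the terms `k` and `k + 1` combine into `bᵏdʲ(da - q bc)aʲcᵏ` with `j = n -
k`, and the bracket is the determinant relation. The weight `q²ʲ` in the rule cancels the cost of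
moving `b` and `c` into the middle. -/
theorem sum_b_d_a_c (h : IsRep q x) (hq : q ≠ 0)
    (hroot : ∀ n : ℕ, 0 < n → (q ^ 2) ^ n ≠ 1) (n : ℕ) :
    ∑ k ∈ range (n + 1), qBinom (q ^ 2) n k • ((-q) ^ k •
      (x .b ^ k * x .d ^ (n - k) * (x .a ^ (n - k) * x .c ^ k))) = 1 := by
  induction n with
  | zero => simp [qBinom_zero_right hroot]
  | succ n ih =>
    rw [sum_qBinom_succ_smul hroot, ← ih]
    refine sum_congr rfl fun k hk => ?_
    congr 1
    obtain ⟨j, rfl⟩ := Nat.exists_eq_add_of_le (mem_range_succ_iff.1 hk)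
    have e1 : k + j + 1 - k = j + 1 := by omega
    have e2 : k + j + 1 - (k + 1) = j := by omega
    rw [e1, e2, Nat.add_sub_cancel_left]
    have h1 : x .b ^ k * x .d ^ (j + 1) * (x .a ^ (j + 1) * x .c ^ k) =
        x .b ^ k * x .d ^ j * (x .d * x .a) * (x .a ^ j * x .c ^ k) := by
      rw [pow_succ (x .d), pow_succ' (x .a)]
      simp only [mul_assoc]
    have h2 : x .b ^ (k + 1) * x .d ^ j * (x .a ^ j * x .c ^ (k + 1)) =
        (q⁻¹ ^ j * q⁻¹ ^ j) • (x .b ^ k * x .d ^ j * (x .b * x .c) * (x .a ^ j * x .c ^ k)) := by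
      have h3 : x .b * x .d ^ j = q⁻¹ ^ j • (x .d ^ j * x .b) := mul_pow_of_qcommute h.bd j
      have h4 : x .a ^ j * x .c = q⁻¹ ^ j • (x .c * x .a ^ j) := pow_mul_of_qcommute h.ac j
      rw [pow_succ (x .b), pow_succ' (x .c), mul_assoc (x .b ^ k), h3, ← mul_assoc (x .a ^ j), h4,
        mul_smul_comm, smul_mul_assoc, smul_mul_assoc, mul_smul_comm, smul_smul]
      simp only [mul_assoc]
    rw [h1, h2, h.da_eq, mul_eq_smul_zetaOf x hq]
    simp only [mul_sub, sub_mul, mul_one, mul_smul_comm, smul_mul_assoc]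
    have h5 : (q ^ 2) ^ j * (q⁻¹ ^ j * q⁻¹ ^ j) = 1 := by
      rw [← mul_pow, ← mul_pow]; field_simp; simp
    match_scalars
    · ring
    · linear_combination (q ^ 2 * (-q) ^ k) * h5

/-- The mirror argument with `ad - q⁻¹ bc = 1` in the middle. Here `a` and `d` are moved across `cᵏ`
and `bᵏ`, which requires the other Pascal rule, with weight `q²ᵏ`. -/
theorem sum_a_c_b_d (h : IsRep q x) (hq : q ≠ 0)
    (hroot : ∀ n : ℕ, 0 < n → (q ^ 2) ^ n ≠ 1) (n : ℕ) :
    ∑ k ∈ range (n + 1), qBinom (q ^ 2) n k • (((-q) ^ k)⁻¹ •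
      (x .a ^ (n - k) * x .c ^ k * (x .b ^ k * x .d ^ (n - k)))) = 1 := by
  induction n with
  | zero => simp [qBinom_zero_right hroot]
  | succ n ih =>
    rw [sum_qBinom_succ_smul' hroot, ← ih]
    refine sum_congr rfl fun k hk => ?_
    congr 1
    obtain ⟨j, rfl⟩ := Nat.exists_eq_add_of_le (mem_range_succ_iff.1 hk)
    have e1 : k + j + 1 - k = j + 1 := by omega
    have e2 : k + j + 1 - (k + 1) = j := by omega
    rw [e1, e2, Nat.add_sub_cancel_left]
    have h1 : x .a ^ (j + 1) * x .c ^ k * (x .b ^ k * x .d ^ (j + 1)) =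
        (q⁻¹ ^ k * q⁻¹ ^ k) • (x .a ^ j * x .c ^ k * (x .a * x .d) * (x .b ^ k * x .d ^ j)) := by
      have h3 : x .a * x .c ^ k = q⁻¹ ^ k • (x .c ^ k * x .a) := mul_pow_of_qcommute h.ac k
      have h4 : x .b ^ k * x .d = q⁻¹ ^ k • (x .d * x .b ^ k) := pow_mul_of_qcommute h.bd k
      rw [pow_succ (x .a), pow_succ' (x .d), mul_assoc (x .a ^ j), h3, ← mul_assoc (x .b ^ k), h4,
        mul_smul_comm, smul_mul_assoc, smul_mul_assoc, mul_smul_comm, smul_smul]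
      simp only [mul_assoc]
    have h2 : x .a ^ j * x .c ^ (k + 1) * (x .b ^ (k + 1) * x .d ^ j) =
        x .a ^ j * x .c ^ k * (x .b * x .c) * (x .b ^ k * x .d ^ j) := by
      rw [pow_succ (x .c), pow_succ' (x .b), h.bc]
      simp only [mul_assoc]
    rw [h1, h2, h.ad_eq, mul_eq_smul_zetaOf x hq]
    simp only [mul_sub, sub_mul, mul_one, mul_smul_comm, smul_mul_assoc]
    have h5 : (q ^ 2) ^ k * (q⁻¹ ^ k * q⁻¹ ^ k) = 1 := by
      rw [← mul_pow, ← mul_pow]; field_simp; simp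
    have h6 : ((-q) ^ (k + 1))⁻¹ * -q = ((-q) ^ k)⁻¹ := by
      rw [pow_succ, mul_inv, mul_assoc, inv_mul_cancel₀ (neg_ne_zero.2 hq), mul_one]
    match_scalars
    · linear_combination ((-q) ^ k)⁻¹ * h5
    · linear_combination -((-q) ^ k)⁻¹ * h5 + h6

/-! ### The diagonal sums -/

/-- In each Pascal pair, one term wraps the previous summand in `a … d`, while the other inserts a
factor `bc` in the middle. Moved to the front as `ζ`, this factor absorbs the weight `q²ʲ`. -/
theorem diagonal_neg_succ (h : IsRep q x) (hq : q ≠ 0)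
    (hroot : ∀ n : ℕ, 0 < n → (q ^ 2) ^ n ≠ 1) (n : ℕ) :
    ∑ k ∈ range (n + 2), qBinom (q ^ 2) (n + 1) k • ((-q) ^ k •
      (x .a ^ (n + 1 - k) * x .c ^ k * (x .b ^ k * x .d ^ (n + 1 - k)))) =
    x .a * (∑ k ∈ range (n + 1), qBinom (q ^ 2) n k • ((-q) ^ k •
      (x .a ^ (n - k) * x .c ^ k * (x .b ^ k * x .d ^ (n - k))))) * x .d +
    q ^ 2 • (zetaOf q x * ∑ k ∈ range (n + 1), qBinom (q ^ 2) n k • ((-q) ^ k •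
      (x .a ^ (n - k) * x .c ^ k * (x .b ^ k * x .d ^ (n - k))))) := by
  rw [sum_qBinom_succ_smul hroot, mul_sum, mul_sum, sum_mul, smul_sum, ← sum_add_distrib]
  refine sum_congr rfl fun k hk => ?_
  simp only [mul_smul_comm, smul_mul_assoc]
  rw [smul_comm (q ^ 2), ← smul_add]
  congr 1
  obtain ⟨j, rfl⟩ := Nat.exists_eq_add_of_le (mem_range_succ_iff.1 hk)
  have e1 : k + j + 1 - k = j + 1 := by omega
  have e2 : k + j + 1 - (k + 1) = j := by omega
  rw [e1, e2, Nat.add_sub_cancel_left]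
  congr 1
  · rw [pow_succ' (x .a), pow_succ (x .d)]
    simp only [mul_assoc]
  · have h1 : zetaOf q x * x .a ^ j = (q ^ 2) ^ j • (x .a ^ j * zetaOf q x) :=
      mul_pow_of_qcommute (h.zeta_mul_a hq) j
    have h2 : Commute (zetaOf q x) (x .c ^ k) := Commute.pow_right h.zeta_mul_c k
    have h3 : x .a ^ j * x .c ^ (k + 1) * (x .b ^ (k + 1) * x .d ^ j) =
        (-q) • (x .a ^ j * x .c ^ k * zetaOf q x * (x .b ^ k * x .d ^ j)) := by
      rw [pow_succ (x .c), pow_succ' (x .b), ← smul_mul_assoc, ← mul_smul_comm,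
        ← mul_eq_smul_zetaOf x hq, h.bc]
      simp only [mul_assoc]
    rw [h3, ← mul_assoc (zetaOf q x), ← mul_assoc (zetaOf q x), h1, smul_mul_assoc,
      mul_assoc (x .a ^ j) (zetaOf q x), h2.eq, ← mul_assoc (x .a ^ j), smul_mul_assoc]
    match_scalars
    ring

theorem diagonal_pos_succ (h : IsRep q x) (hq : q ≠ 0)
    (hroot : ∀ n : ℕ, 0 < n → (q ^ 2) ^ n ≠ 1) (n : ℕ) :
    ∑ k ∈ range (n + 2), qBinom (q ^ 2) (n + 1) k • (((-q) ^ k)⁻¹ •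
      (x .b ^ k * x .d ^ (n + 1 - k) * (x .a ^ (n + 1 - k) * x .c ^ k))) =
    x .d * (∑ k ∈ range (n + 1), qBinom (q ^ 2) n k • (((-q) ^ k)⁻¹ •
      (x .b ^ k * x .d ^ (n - k) * (x .a ^ (n - k) * x .c ^ k)))) * x .a +
    zetaOf q x * ∑ k ∈ range (n + 1), qBinom (q ^ 2) n k • (((-q) ^ k)⁻¹ •
      (x .b ^ k * x .d ^ (n - k) * (x .a ^ (n - k) * x .c ^ k))) := by
  rw [sum_qBinom_succ_smul' hroot, mul_sum, mul_sum, sum_mul, ← sum_add_distrib]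
  refine sum_congr rfl fun k hk => ?_
  simp only [mul_smul_comm, smul_mul_assoc]
  rw [← smul_add]
  congr 1
  obtain ⟨j, rfl⟩ := Nat.exists_eq_add_of_le (mem_range_succ_iff.1 hk)
  have e1 : k + j + 1 - k = j + 1 := by omega
  have e2 : k + j + 1 - (k + 1) = j := by omega
  rw [e1, e2, Nat.add_sub_cancel_left]
  congr 1
  · have h1 : x .d * x .b ^ k = q ^ k • (x .b ^ k * x .d) := mul_pow_of_qcommute (h.db hq) k
    have h2 : x .c ^ k * x .a = q ^ k • (x .a * x .c ^ k) := pow_mul_of_qcommute (h.ca hq) k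
    have h3 : x .d * (x .b ^ k * x .d ^ j * (x .a ^ j * x .c ^ k)) * x .a =
        (x .d * x .b ^ k) * x .d ^ j * (x .a ^ j * (x .c ^ k * x .a)) := by
      simp only [mul_assoc]
    rw [h3, h1, h2, pow_succ' (x .d), pow_succ (x .a)]
    simp only [smul_mul_assoc, mul_smul_comm, mul_assoc]
    match_scalars
    ring
  · have h1 : x .c * x .d ^ j = q⁻¹ ^ j • (x .d ^ j * x .c) := mul_pow_of_qcommute h.cd j
    have h2 : x .c * x .a ^ j = q ^ j • (x .a ^ j * x .c) := mul_pow_of_qcommute (h.ca hq) j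
    have h3 : q⁻¹ ^ j * q ^ j = 1 := by rw [← mul_pow, inv_mul_cancel₀ hq, one_pow]
    have h4 : x .d ^ j * (x .a ^ j * x .c ^ (k + 1)) = x .c * (x .d ^ j * (x .a ^ j * x .c ^ k)) := by
      rw [← mul_assoc (x .c), h1, smul_mul_assoc, mul_assoc (x .d ^ j), ← mul_assoc (x .c), h2,
        smul_mul_assoc, mul_smul_comm, smul_smul, h3, one_smul, mul_assoc (x .a ^ j), ← pow_succ']
    have h5 : x .b ^ k * x .c = x .c * x .b ^ k := Commute.pow_left h.bc k
    have h6 : ((-q) ^ (k + 1))⁻¹ * -q = ((-q) ^ k)⁻¹ := by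
      rw [pow_succ, mul_inv, mul_assoc, inv_mul_cancel₀ (neg_ne_zero.2 hq), mul_one]
    rw [mul_assoc, h4, pow_succ' (x .b), mul_assoc (x .b), ← mul_assoc (x .b ^ k), h5,
      mul_assoc (x .c), ← mul_assoc (x .b), mul_eq_smul_zetaOf x hq, smul_mul_assoc, smul_smul, h6,
      mul_assoc (x .b ^ k)]

end Unity

/-! ### The values of the traces on the diagonal sums -/

section Values

open Polynomial

/-- The polynomial `g` with `∑ₖ binom(n, k) (-q)ᵏ aⁿ⁻ᵏ cᵏ bᵏ dⁿ⁻ᵏ = g(ζ)`. -/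
def diagPolyNeg (q : ℂ) : ℕ → ℂ[X]
  | 0 => 1
  | n + 1 => dilate (q⁻¹ ^ 2) (diagPolyNeg q n) * (1 - X) + C (q ^ 2) * (X * diagPolyNeg q n)

/-- The polynomial `g` with `∑ₖ binom(n, k) (-q)⁻ᵏ bᵏ dⁿ⁻ᵏ aⁿ⁻ᵏ cᵏ = g(ζ)`. -/
def diagPolyPos (q : ℂ) : ℕ → ℂ[X]
  | 0 => 1
  | n + 1 => dilate (q ^ 2) (diagPolyPos q n) * (1 - C (q ^ 2) * X) + X * diagPolyPos q n

theorem aeval_mul_of_qcommute {B : Type} [Ring B] [Algebra ℂ B] {y z : B} {s : ℂ}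
    (h : y * z = s • (z * y)) (p : ℂ[X]) : y * aeval z p = aeval z (dilate s p) * y := by
  induction p using Polynomial.induction_on' with
  | add p r hp hr => simp only [map_add, mul_add, add_mul, hp, hr]
  | monomial n t =>
    have h1 : dilate s (monomial n t) = monomial n (t * s ^ n) := by
      rw [← C_mul_X_pow_eq_monomial, ← C_mul_X_pow_eq_monomial]
      simp only [map_mul, map_pow, dilate_C, dilate_X]
      ring
    rw [h1, aeval_monomial, aeval_monomial, ← Algebra.smul_def, ← Algebra.smul_def, mul_smul_comm,
      mul_pow_of_qcommute h, smul_smul, smul_mul_assoc]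

variable {B : Type} [Ring B] [Algebra ℂ B] {x : Gen → B}

open Finset

theorem diagonal_neg_eq_aeval (h : IsRep q x) (hq : q ≠ 0)
    (hroot : ∀ n : ℕ, 0 < n → (q ^ 2) ^ n ≠ 1) (n : ℕ) :
    ∑ k ∈ range (n + 1), qBinom (q ^ 2) n k • ((-q) ^ k •
      (x .a ^ (n - k) * x .c ^ k * (x .b ^ k * x .d ^ (n - k)))) =
    aeval (zetaOf q x) (diagPolyNeg q n) := by
  induction n with
  | zero => simp [diagPolyNeg, qBinom_zero_right hroot]
  | succ n ih =>
    have h1 : x .a * zetaOf q x = q⁻¹ ^ 2 • (zetaOf q x * x .a) := by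
      rw [h.zeta_mul_a hq, smul_smul, ← mul_pow, inv_mul_cancel₀ hq, one_pow, one_smul]
    rw [diagonal_neg_succ h hq hroot, ih, aeval_mul_of_qcommute h1, mul_assoc, h.ad_eq, diagPolyNeg]
    simp [Algebra.smul_def]

theorem diagonal_pos_eq_aeval (h : IsRep q x) (hq : q ≠ 0)
    (hroot : ∀ n : ℕ, 0 < n → (q ^ 2) ^ n ≠ 1) (n : ℕ) :
    ∑ k ∈ range (n + 1), qBinom (q ^ 2) n k • (((-q) ^ k)⁻¹ •
      (x .b ^ k * x .d ^ (n - k) * (x .a ^ (n - k) * x .c ^ k))) =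
    aeval (zetaOf q x) (diagPolyPos q n) := by
  induction n with
  | zero => simp [diagPolyPos, qBinom_zero_right hroot]
  | succ n ih =>
    have h1 : x .d * zetaOf q x = q ^ 2 • (zetaOf q x * x .d) := by
      rw [h.zeta_mul_d, smul_smul, ← mul_pow, mul_inv_cancel₀ hq, one_pow, one_smul]
    rw [diagonal_pos_succ h hq hroot, ih, aeval_mul_of_qcommute h1, mul_assoc, h.da_eq, diagPolyPos]
    simp [Algebra.smul_def]

theorem eval_zero_diagPolyNeg (n : ℕ) : (diagPolyNeg q n).eval 0 = 1 := by
  induction n with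
  | zero => simp [diagPolyNeg]
  | succ n ih => simp [diagPolyNeg, eval_dilate, ih]

theorem eval_zero_diagPolyPos (n : ℕ) : (diagPolyPos q n).eval 0 = 1 := by
  induction n with
  | zero => simp [diagPolyPos]
  | succ n ih => simp [diagPolyPos, eval_dilate, ih]

variable {hq : q ≠ 0}

/-- The counit takes `p(ζ)` to `p(0)`. -/
theorem tau0_aeval (p : ℂ[X]) : tau0 hq (aeval (elemZeta hq) p) = p.eval 0 := by
  have h1 : tau0 hq (aeval (elemZeta hq) p) =
      ((counit q).comp (sphere q hq).val) (aeval (elemZeta hq) p) := rfl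
  have h2 : ((counit q).comp (sphere q hq).val) (elemZeta hq) = 0 := by
    simp [elemZeta, counit, counitGen]
  rw [h1, ← aeval_algHom_apply, h2, coe_aeval_eq_eval]

/-- The telescoping rule for `τ¹` on polynomials in `ζ`. -/
theorem IsChernTrace.apply_aeval_sub_dilate {τ : sphere q hq →ₗ[ℂ] ℂ} (h : IsChernTrace hq τ)
    (hroot : ∀ n : ℕ, 0 < n → q ^ n ≠ 1) (p : ℂ[X]) :
    τ (aeval (elemZeta hq) (p - dilate (q ^ 2) p)) = p.eval 1 - p.eval 0 := by
  induction p using Polynomial.induction_on' with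
  | add p r hp hr =>
    have : p + r - dilate (q ^ 2) (p + r) =
        (p - dilate (q ^ 2) p) + (r - dilate (q ^ 2) r) := by rw [map_add]; ring
    rw [this, map_add, map_add, hp, hr, eval_add, eval_add]
    ring
  | monomial n t =>
    have h1 : monomial n t - dilate (q ^ 2) (monomial n t) = C (t * (1 - q ^ (2 * n))) * X ^ n := by
      rw [← C_mul_X_pow_eq_monomial]
      simp only [map_mul, map_pow, dilate_C, dilate_X, map_sub, map_one, pow_mul]
      ring
    rw [h1, map_mul, map_pow, aeval_C, aeval_X, ← Algebra.smul_def, map_smul, h.apply_zeta_pow]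
    rcases Nat.eq_zero_or_pos n with rfl | hn
    · simp
    · have : 1 - q ^ (2 * n) ≠ 0 := sub_ne_zero.2 (hroot _ (by omega)).symm
      simp [this, hn.ne']

theorem IsChernTrace.apply_aeval_diagPolyNeg {τ : sphere q hq →ₗ[ℂ] ℂ} (h : IsChernTrace hq τ)
    (hroot : ∀ n : ℕ, 0 < n → q ^ n ≠ 1) (n : ℕ) :
    τ (aeval (elemZeta hq) (diagPolyNeg q n)) = -n := by
  induction n with
  | zero => simpa [diagPolyNeg] using h.apply_zeta_pow 0
  | succ n ih =>
    have h1 : q ^ 2 * q⁻¹ ^ 2 = 1 := by rw [← mul_pow, mul_inv_cancel₀ hq, one_pow]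
    -- With `f(X) = g(q⁻²X)(1 - X)`, the recursion reads `g + (f(X) - f(q²X))`. As `f(1) = 0` and
    -- `f(0) = 1`, the trace drops by one.
    have h2 : diagPolyNeg q (n + 1) = diagPolyNeg q n +
        (dilate (q⁻¹ ^ 2) (diagPolyNeg q n) * (1 - X) -
          dilate (q ^ 2) (dilate (q⁻¹ ^ 2) (diagPolyNeg q n) * (1 - X))) := by
      rw [map_mul, dilate_dilate h1, map_sub, map_one, dilate_X, diagPolyNeg]
      ring
    rw [h2, map_add, map_add, ih, h.apply_aeval_sub_dilate hroot]
    simp [eval_dilate, eval_zero_diagPolyNeg]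
    ring

theorem IsChernTrace.apply_aeval_diagPolyPos {τ : sphere q hq →ₗ[ℂ] ℂ} (h : IsChernTrace hq τ)
    (hroot : ∀ n : ℕ, 0 < n → q ^ n ≠ 1) (n : ℕ) :
    τ (aeval (elemZeta hq) (diagPolyPos q n)) = n := by
  induction n with
  | zero => simpa [diagPolyPos] using h.apply_zeta_pow 0
  | succ n ih =>
    -- Now `f(X) = (1 - X) g(X)` enters with the opposite sign, so the trace rises by one.
    have h2 : diagPolyPos q (n + 1) = diagPolyPos q n -
        ((1 - X) * diagPolyPos q n - dilate (q ^ 2) ((1 - X) * diagPolyPos q n)) := by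
      rw [map_mul, map_sub, map_one, dilate_X, diagPolyPos]
      ring
    rw [h2, map_sub, map_sub, ih, h.apply_aeval_sub_dilate hroot]
    simp [eval_zero_diagPolyPos]

end Values

/-! ### The projectors -/

/-- A column times a row is idempotent as soon as the row times the column is `1`; this is the
entrywise form with the scalars kept apart. -/
theorem sum_smul_mul_smul_eq {B ι : Type*} [Ring B] [Algebra ℂ B] [Fintype ι] {r s : ι → ℂ}
    {y w : ι → B} (h : ∑ i, r i • (s i • (y i * w i)) = 1) (t : ℂ) (u v : B) :
    ∑ i, ((r i * s i) • (u * y i)) * (t • (w i * v)) = t • (u * v) := by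
  have h1 (i : ι) : ((r i * s i) • (u * y i)) * (t • (w i * v)) =
      t • (u * (r i • (s i • (y i * w i))) * v) := by
    simp only [smul_mul_assoc, mul_smul_comm, mul_assoc, smul_smul]
  rw [Finset.sum_congr rfl fun i _ => h1 i, ← Finset.smul_sum, ← Finset.sum_mul, ← Finset.mul_sum,
    h, mul_one]

theorem isIdempotentElem_hopfProj (hq : q ≠ 0) (hroot : ∀ n : ℕ, 0 < n → q ^ n ≠ 1) (μ : ℤ) :
    IsIdempotentElem (hopfProj hq μ) := by
  have hroot' (n : ℕ) (hn : 0 < n) : (q ^ 2) ^ n ≠ 1 := by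
    rw [← pow_mul]; exact hroot _ (by omega)
  ext k l
  simp only [Matrix.mul_apply, AddSubmonoidClass.coe_finsetSum, hopfProj, Matrix.of_apply,
    MulMemClass.coe_mul, hopfEntry]
  by_cases h : μ ≤ 0
  · simp only [if_pos h]
    have h1 := sum_b_d_a_c (isRep_gen q) hq hroot' μ.natAbs
    rw [← Fin.sum_univ_eq_sum_range (fun i => qBinom (q ^ 2) μ.natAbs i • ((-q) ^ i •
      (gen q .b ^ i * gen q .d ^ (μ.natAbs - i) *
        (gen q .a ^ (μ.natAbs - i) * gen q .c ^ i))))] at h1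
    exact sum_smul_mul_smul_eq h1 _ _ _
  · simp only [if_neg h]
    have h1 := sum_a_c_b_d (isRep_gen q) hq hroot' μ.natAbs
    rw [← Fin.sum_univ_eq_sum_range (fun i => qBinom (q ^ 2) μ.natAbs i • (((-q) ^ i)⁻¹ •
      (gen q .a ^ (μ.natAbs - i) * gen q .c ^ i *
        (gen q .b ^ i * gen q .d ^ (μ.natAbs - i)))))] at h1
    exact sum_smul_mul_smul_eq h1 _ _ _

/-- The trace of `e_μ` is a polynomial in `ζ`. -/
theorem trace_hopfProj (hq : q ≠ 0) (hroot : ∀ n : ℕ, 0 < n → q ^ n ≠ 1) (μ : ℤ) :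
    (hopfProj hq μ).trace = Polynomial.aeval (elemZeta hq)
      (if μ ≤ 0 then diagPolyNeg q μ.natAbs else diagPolyPos q μ.natAbs) := by
  have hroot' (n : ℕ) (hn : 0 < n) : (q ^ 2) ^ n ≠ 1 := by
    rw [← pow_mul]; exact hroot _ (by omega)
  apply Subtype.ext
  have hcoe (p : Polynomial ℂ) : ((Polynomial.aeval (elemZeta hq) p : sphere q hq) : SL q) =
      Polynomial.aeval (zetaOf q (gen q)) p :=
    (Polynomial.aeval_algHom_apply (sphere q hq).val (elemZeta hq) p).symm
  rw [hcoe]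
  simp only [Matrix.trace, Matrix.diag, AddSubmonoidClass.coe_finsetSum, hopfProj, Matrix.of_apply]
  rw [Fin.sum_univ_eq_sum_range (fun k => hopfEntry q μ k k)]
  simp only [hopfEntry]
  split_ifs with h
  · rw [← diagonal_neg_eq_aeval (isRep_gen q) hq hroot']
    simp only [smul_smul]
  · rw [← diagonal_pos_eq_aeval (isRep_gen q) hq hroot']
    simp only [smul_smul]

theorem tau0_trace_hopfProj (hq : q ≠ 0) (hroot : ∀ n : ℕ, 0 < n → q ^ n ≠ 1) (μ : ℤ) :
    tau0 hq (hopfProj hq μ).trace = 1 := by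
  rw [trace_hopfProj hq hroot, tau0_aeval]
  split_ifs
  · exact eval_zero_diagPolyNeg _
  · exact eval_zero_diagPolyPos _

theorem IsChernTrace.apply_trace_hopfProj {hq : q ≠ 0} {τ : sphere q hq →ₗ[ℂ] ℂ}
    (h : IsChernTrace hq τ) (hroot : ∀ n : ℕ, 0 < n → q ^ n ≠ 1) (μ : ℤ) :
    τ (hopfProj hq μ).trace = μ := by
  rw [trace_hopfProj hq hroot]
  split_ifs with h0
  · rw [h.apply_aeval_diagPolyNeg hroot, ← Int.cast_natCast, Int.ofNat_natAbs_of_nonpos h0]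
    simp
  · rw [h.apply_aeval_diagPolyPos hroot, ← Int.cast_natCast, Int.natAbs_of_nonneg (by omega)]

end QSphere

/-! ### Embedding `ℂ` into a complete normed field in which `q` is small. -/

namespace IsAlgClosed

open Cardinal

/-- Two algebraically closed fields of the cardinality of the continuum that contain a countable
ring `R` are isomorphic over `R`. -/
theorem exists_ringEquiv_comp_eq {R K L : Type} [CommRing R] [Countable R] [Field K] [Field L]
    [IsAlgClosed K] [IsAlgClosed L] (hK : #K = 𝔠) (hL : #L = 𝔠) (f : R →+* K) (g : R →+* L)
    (hf : Function.Injective f) (hg : Function.Injective g) :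
    ∃ φ : K ≃+* L, ∀ r, φ (f r) = g r := by
  let := f.toAlgebra
  let := g.toAlgebra
  have : FaithfulSMul R K := (faithfulSMul_iff_algebraMap_injective R K).2 hf
  have : FaithfulSMul R L := (faithfulSMul_iff_algebraMap_injective R L).2 hg
  have : Nontrivial R := f.domain_nontrivial
  obtain ⟨ι, v, hv⟩ := exists_isTranscendenceBasis' R K
  obtain ⟨κ, w, hw⟩ := exists_isTranscendenceBasis' R L
  -- Over a countable ring, an uncountable algebraically closed field is as large as its
  -- transcendence basis. So both bases have size continuum, and a bijection between them extends to
  -- the algebraic closures.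
  have h1 := cardinal_eq_cardinal_transcendence_basis_of_aleph0_lt v hv mk_le_aleph0
    (hK ▸ aleph0_lt_continuum)
  have h2 := cardinal_eq_cardinal_transcendence_basis_of_aleph0_lt w hw mk_le_aleph0
    (hL ▸ aleph0_lt_continuum)
  simp only [lift_id] at h1 h2
  obtain ⟨e⟩ := Cardinal.eq.1 (h1.symm.trans (hK.trans (hL.symm.trans h2)))
  let := isAlgClosure_of_transcendence_basis v hv
  let := isAlgClosure_of_transcendence_basis w hw
  let E : Algebra.adjoin R (Set.range v) ≃ₐ[R] Algebra.adjoin R (Set.range w) :=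
    hv.1.aevalEquiv.symm.trans ((MvPolynomial.renameEquiv R e).trans hw.1.aevalEquiv)
  refine ⟨IsAlgClosure.equivOfEquiv K L E.toRingEquiv, fun r => ?_⟩
  have h3 : f r = algebraMap (Algebra.adjoin R (Set.range v)) K (algebraMap R _ r) := rfl
  rw [h3, IsAlgClosure.equivOfEquiv_algebraMap]
  have h4 : E.toRingEquiv (algebraMap R _ r) = algebraMap R _ r := E.commutes r
  rw [h4]
  rfl

end IsAlgClosed

namespace PadicAlgCl

open Cardinal

theorem mk_eq_continuum (p : ℕ) [Fact p.Prime] : #(PadicAlgCl p) = 𝔠 := by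
  apply le_antisymm
  · refine (Algebra.IsAlgebraic.cardinalMk_le_max ℚ_[p] (PadicAlgCl p)).trans
      (max_le ?_ aleph0_le_continuum)
    refine (mk_quotient_le).trans ((mk_subtype_le _).trans ?_)
    simp
  · exact (continuum_le_cardinal_of_nontriviallyNormedField ℚ_[p]).trans
      (mk_le_of_injective (algebraMap ℚ_[p] (PadicAlgCl p)).injective)

end PadicAlgCl

/-- A rational number that is a `p`-adic integer for all `p` is an integer. -/
theorem Rat.den_eq_one_of_padic_norm_le_one {x : ℚ}
    (h : ∀ (p : ℕ) [Fact p.Prime], ‖(x : ℚ_[p])‖ ≤ 1) : x.den = 1 := by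
  by_contra hd
  obtain ⟨p, hp, hpd⟩ := Nat.exists_prime_and_dvd hd
  have : Fact p.Prime := ⟨hp⟩
  have h1 : ‖((x.den : ℤ) : ℚ_[p])‖ < 1 :=
    (Padic.norm_intCast_lt_one_iff).2 (Int.natCast_dvd_natCast.2 hpd)
  have h2 : ((x.num : ℤ) : ℚ_[p]) = (x : ℚ_[p]) * ((x.den : ℤ) : ℚ_[p]) := by
    have := Rat.mul_den_eq_num x
    exact_mod_cast this.symm
  have h3 : ‖(x.num : ℚ_[p])‖ < 1 := by
    rw [h2, norm_mul]
    exact (mul_le_of_le_one_left (norm_nonneg _) (h p)).trans_lt h1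
  have h4 := (Padic.norm_intCast_lt_one_iff).1 h3
  have h5 := Nat.dvd_gcd (Int.natCast_dvd.1 h4) hpd
  rw [x.reduced] at h5
  exact hp.one_lt.ne' (Nat.dvd_one.1 h5)

open Polynomial in
/-- An algebraic number with all its conjugates in `p`-adic closed unit balls is integral. -/
theorem isIntegral_of_padic_norm_roots_le_one {t : ℂ} (ht : IsIntegral ℚ t)
    (h : ∀ (p : ℕ) [Fact p.Prime] (r : PadicAlgCl p), aeval r (minpoly ℚ t) = 0 → ‖r‖ ≤ 1) :
    IsIntegral ℤ t := by
  have hcoeff (n : ℕ) : ((minpoly ℚ t).coeff n).den = 1 := by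
    refine Rat.den_eq_one_of_padic_norm_le_one fun p _ => ?_
    -- A monic polynomial that splits with all roots in the valuation ring has its coefficients
    -- there.
    let O : Subring (PadicAlgCl p) := (NormedField.valuation (K := PadicAlgCl p)).integer
    have hs := IsAlgClosed.splits ((minpoly ℚ t).map (algebraMap ℚ (PadicAlgCl p)))
    have hmem : (minpoly ℚ t).map (algebraMap ℚ (PadicAlgCl p)) ∈ liftsRing O.subtype := by
      rw [hs.eq_prod_roots_of_monic ((minpoly.monic ht).map _)]
      refine Subring.multiset_prod_mem _ _ fun a ha => ?_
      obtain ⟨r, hr, rfl⟩ := Multiset.mem_map.1 ha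
      have hr1 : ‖r‖ ≤ 1 := by
        refine h p r ?_
        have := (mem_roots'.1 hr).2
        rwa [IsRoot, eval_map_algebraMap] at this
      exact sub_mem ⟨X, by simp⟩ ⟨C ⟨r, hr1⟩, by simp⟩
    obtain ⟨y, hy⟩ := (lifts_iff_coeff_lifts _).1 ((lifts_iff_liftsRing _ _).2 hmem) n
    have hy1 : ‖(y : PadicAlgCl p)‖ ≤ 1 := y.2
    rw [← PadicAlgCl.norm_extends, map_ratCast]
    rw [coeff_map, eq_ratCast] at hy
    rwa [← hy]
  have hlift : minpoly ℚ t ∈ lifts (Int.castRingHom ℚ) :=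
    (lifts_iff_coeff_lifts _).2 fun n => ⟨_, Rat.coe_int_num_of_den_eq_one (hcoeff n)⟩
  obtain ⟨P, hP, -, hmonic⟩ := lifts_and_natDegree_eq_and_monic hlift (minpoly.monic ht)
  refine ⟨P, hmonic, ?_⟩
  have h0 := minpoly.aeval ℚ t
  rw [← hP, aeval_def, eval₂_map,
    Subsingleton.elim ((algebraMap ℚ ℂ).comp (Int.castRingHom ℚ)) (algebraMap ℤ ℂ)] at h0
  exact h0

open Cardinal Polynomial in
/-- A nonzero complex number that is not a root of unity is small in some complete normed field. -/
theorem exists_complete_normedField_norm_lt_one {q : ℂ} (hq : q ≠ 0)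
    (hroot : ∀ n : ℕ, 0 < n → q ^ n ≠ 1) :
    ∃ (K : Type) (_ : NormedField K) (_ : CompleteSpace K) (φ : ℂ →+* K), ‖φ q‖ < 1 := by
  suffices h : ∃ (K : Type) (_ : NormedField K) (_ : CompleteSpace K) (φ : ℂ →+* K),
      1 < ‖φ q⁻¹‖ by
    obtain ⟨K, _, _, φ, h⟩ := h
    refine ⟨K, _, ‹_›, φ, ?_⟩
    rw [map_inv₀, norm_inv] at h
    have h0 : 0 < ‖φ q‖ := norm_pos_iff.2 ((map_ne_zero φ).2 hq)
    exact (one_lt_inv₀ h0).1 h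
  -- Working with the inverse fits the tools: Kronecker's theorem and failure of integrality both
  -- produce conjugates of norm greater than `1`.
  have ht0 : q⁻¹ ≠ 0 := inv_ne_zero hq
  have htroot (n : ℕ) (hn : 0 < n) : q⁻¹ ^ n ≠ 1 := by
    rw [inv_pow, Ne, inv_eq_one]
    exact hroot n hn
  generalize q⁻¹ = t at ht0 htroot
  by_cases halg : IsAlgebraic ℚ t
  · have hint : IsIntegral ℚ t := halg.isIntegral
    have : FiniteDimensional ℚ (IntermediateField.adjoin ℚ {t}) :=
      IntermediateField.adjoin.finiteDimensional hint
    have : NumberField (IntermediateField.adjoin ℚ {t}) := ⟨⟩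
    have : Countable (IntermediateField.adjoin ℚ {t}) := by
      have := Algebra.IsAlgebraic.cardinalMk_le_max ℚ (IntermediateField.adjoin ℚ {t})
      rw [max_eq_left (by simp)] at this
      exact mk_le_aleph0_iff.1 (this.trans (by simp))
    have hgen : ((IntermediateField.AdjoinSimple.gen ℚ t : IntermediateField.adjoin ℚ {t}) : ℂ) = t :=
      IntermediateField.AdjoinSimple.coe_gen ℚ t
    by_cases htZ : IsIntegral ℤ t
    · obtain ⟨ψ, hψ⟩ : ∃ ψ : IntermediateField.adjoin ℚ {t} →+* ℂ,
          1 < ‖ψ (IntermediateField.AdjoinSimple.gen ℚ t)‖ := by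
        -- Kronecker: an algebraic integer all of whose conjugates lie in the closed unit disc is
        -- zero or a root of unity.
        by_contra! hle
        obtain ⟨n, hn, hn1⟩ := NumberField.Embeddings.pow_eq_one_of_norm_le_one _ ℂ
          (x := IntermediateField.AdjoinSimple.gen ℚ t)
          (fun h => ht0 (by rw [← hgen, h, ZeroMemClass.coe_zero]))
          ((isIntegral_algebraMap_iff
            (algebraMap (IntermediateField.adjoin ℚ {t}) ℂ).injective).1 (hgen ▸ htZ)) hle
        refine htroot n hn ?_
        rw [← hgen]
        exact_mod_cast congrArg (algebraMap (IntermediateField.adjoin ℚ {t}) ℂ) hn1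
      obtain ⟨φ, hφ⟩ := IsAlgClosed.exists_ringEquiv_comp_eq mk_complex mk_complex
        (algebraMap (IntermediateField.adjoin ℚ {t}) ℂ) ψ (RingHom.injective _) ψ.injective
      refine ⟨ℂ, _, inferInstance, φ.toRingHom, ?_⟩
      rw [← hφ] at hψ
      exact hψ
    · obtain ⟨p, hp, r, hr, hr1⟩ : ∃ (p : ℕ) (_ : Fact p.Prime) (r : PadicAlgCl p),
          aeval r (minpoly ℚ t) = 0 ∧ 1 < ‖r‖ := by
        by_contra! hle
        exact htZ (isIntegral_of_padic_norm_roots_le_one hint fun p _ r hr => hle p _ r hr)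
      let ψ : IntermediateField.adjoin ℚ {t} →ₐ[ℚ] PadicAlgCl p :=
        (IntermediateField.algHomAdjoinIntegralEquiv ℚ hint).symm
          ⟨r, (mem_aroots.2 ⟨minpoly.ne_zero hint, hr⟩)⟩
      have hψ : ψ (IntermediateField.AdjoinSimple.gen ℚ t) = r :=
        IntermediateField.algHomAdjoinIntegralEquiv_symm_apply_gen ℚ hint _
      obtain ⟨φ, hφ⟩ := IsAlgClosed.exists_ringEquiv_comp_eq mk_complex
        (PadicAlgCl.mk_eq_continuum p)
        (algebraMap (IntermediateField.adjoin ℚ {t}) ℂ) ψ.toRingHom (RingHom.injective _)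
        (RingHom.injective _)
      have h1 : φ t = r := by
        rw [← hψ]
        exact hφ (IntermediateField.AdjoinSimple.gen ℚ t)
      -- The algebraic closure of `ℚ_p` is not complete, so it is replaced by its completion, which
      -- extends the norm.
      refine ⟨PadicComplex p, inferInstance, inferInstance,
        (algebraMap (PadicAlgCl p) (PadicComplex p)).comp φ.toRingHom, ?_⟩
      have h2 : ‖algebraMap (PadicAlgCl p) (PadicComplex p) (φ t)‖ = ‖φ t‖ :=
        PadicComplex.norm_extends p _
      rw [RingHom.comp_apply]
      exact (hr1.trans_eq (by rw [← h1])).trans_eq h2.symm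
  -- Both `t` and `N t` are transcendental, so some automorphism of `ℂ` takes `t` to `N t`; `N` is
  -- chosen to push the norm above `1`.
  · obtain ⟨N, hN⟩ := exists_nat_gt ‖t‖⁻¹
    have htpos : 0 < ‖t‖ := norm_pos_iff.2 ht0
    have hN0 : (0 : ℝ) < N := (inv_pos.2 htpos).trans hN
    have hs : 1 < ‖(N : ℂ) * t‖ := by
      rw [norm_mul, Complex.norm_natCast]
      have := mul_lt_mul_of_pos_right hN htpos
      rwa [inv_mul_cancel₀ htpos.ne'] at this
    have hNC : (N : ℂ) ≠ 0 := by
      intro h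
      rw [h, zero_mul, norm_zero] at hs
      linarith
    have halg' : ¬ IsAlgebraic ℚ ((N : ℂ) * t) := by
      intro h
      refine halg ?_
      have h1 : IsAlgebraic ℚ ((N : ℂ)⁻¹) := (isAlgebraic_natCast N).inv
      have := h1.mul h
      rwa [inv_mul_cancel_left₀ hNC] at this
    have hcount : Countable ℚ[X] := by
      refine mk_le_aleph0_iff.1 ((cardinalMk_le_max).trans ?_)
      simp
    obtain ⟨φ, hφ⟩ := IsAlgClosed.exists_ringEquiv_comp_eq mk_complex mk_complex
      (aeval (R := ℚ) t).toRingHom (aeval (R := ℚ) ((N : ℂ) * t)).toRingHom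
      (transcendental_iff_injective.1 halg) (transcendental_iff_injective.1 halg')
    refine ⟨ℂ, _, inferInstance, φ.toRingHom, ?_⟩
    have h1 : φ t = (N : ℂ) * t := by simpa using hφ X
    exact h1 ▸ hs

/-! ### Idempotents in normed rings -/

open Filter Topology in
/-- In a complete normed ring, an element that is almost idempotent is close to an idempotent. -/
theorem exists_isIdempotentElem_norm_sub_le {A : Type*} [NormedRing A] [CompleteSpace A] {C : ℝ}
    (hC : 0 ≤ C) {x : A} (hx : ‖x‖ ≤ C) (hδ : 14 * (2 * C + 3) * ‖x * x - x‖ ≤ 1) :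
    ∃ y : A, IsIdempotentElem y ∧ ‖y - x‖ ≤ 2 * (2 * C + 3) * ‖x * x - x‖ := by
  set δ := ‖x * x - x‖ with hδdef
  have hδ0 : 0 ≤ δ := norm_nonneg _
  have hδ1 : 14 * δ ≤ 1 := by nlinarith
  -- The Newton map `z ↦ 3z² - 2z³` for `z² = z`. The defect `v = z² - z` becomes `v²(4v - 3)`.
  let u : ℕ → A := fun n => Nat.rec x (fun _ z => z + ((z * z - z) - z * (z * z - z) -
    z * (z * z - z))) n
  have hu0 : u 0 = x := rfl
  have hus (n : ℕ) : u (n + 1) = u n + ((u n * u n - u n) - u n * (u n * u n - u n) -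
    u n * (u n * u n - u n)) := rfl
  have hsq (n : ℕ) : u (n + 1) * u (n + 1) - u (n + 1) = (u n * u n - u n) * (u n * u n - u n) *
      (4 * (u n * u n - u n) - 3) := by
    rw [hus]
    noncomm_ring
  have key (n : ℕ) : ‖u n * u n - u n‖ ≤ δ / 2 ^ n ∧
      ‖u n - x‖ ≤ 2 * (2 * C + 3) * δ * (1 - 1 / 2 ^ n) ∧
      ‖u (n + 1) - u n‖ ≤ (2 * C + 3) * (δ / 2 ^ n) := by
    have step (n : ℕ) (h1 : ‖u n * u n - u n‖ ≤ δ / 2 ^ n)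
        (h2 : ‖u n - x‖ ≤ 2 * (2 * C + 3) * δ * (1 - 1 / 2 ^ n)) :
        ‖u (n + 1) - u n‖ ≤ (2 * C + 3) * (δ / 2 ^ n) := by
      have h3 : ‖u n‖ ≤ C + 1 := by
        have h4 : ‖u n‖ ≤ ‖u n - x‖ + ‖x‖ := by simpa using norm_add_le (u n - x) x
        have h5 : (0 : ℝ) < 1 / 2 ^ n := by positivity
        have h6 : 2 * (2 * C + 3) * δ * (1 - 1 / 2 ^ n) ≤ 2 * (2 * C + 3) * δ := by
          have : 0 ≤ 2 * (2 * C + 3) * δ := by positivity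
          nlinarith
        nlinarith
      rw [hus, add_sub_cancel_left]
      set v := u n * u n - u n
      have h4 : ‖u n * v‖ ≤ (C + 1) * ‖v‖ :=
        (norm_mul_le _ _).trans (mul_le_mul_of_nonneg_right h3 (norm_nonneg _))
      calc ‖v - u n * v - u n * v‖ ≤ ‖v‖ + ‖u n * v‖ + ‖u n * v‖ :=
            (norm_sub_le _ _).trans (add_le_add_left (norm_sub_le _ _) _)
        _ ≤ (2 * C + 3) * ‖v‖ := by linarith
        _ ≤ _ := mul_le_mul_of_nonneg_left h1 (by positivity)
    induction n with
    | zero =>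
      have h1 : ‖u 0 * u 0 - u 0‖ ≤ δ / 2 ^ 0 := by simp [hu0, hδdef]
      have h2 : ‖u 0 - x‖ ≤ 2 * (2 * C + 3) * δ * (1 - 1 / 2 ^ 0) := by simp [hu0]
      exact ⟨h1, h2, step 0 h1 h2⟩
    | succ n ih =>
      obtain ⟨h1, h2, h3⟩ := ih
      have h4 : ‖u (n + 1) * u (n + 1) - u (n + 1)‖ ≤ δ / 2 ^ (n + 1) := by
        rw [hsq]
        set v := u n * u n - u n
        have h5 : ‖v‖ ≤ δ := h1.trans (div_le_self hδ0 (one_le_pow₀ (by norm_num)))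
        have h6 : v * v * (4 * v - 3) = v * v * v + v * v * v + v * v * v + v * v * v
          - v * v - v * v - v * v := by noncomm_ring
        have h7 : ‖v * v‖ ≤ ‖v‖ * ‖v‖ := norm_mul_le _ _
        have h8 : ‖v * v * v‖ ≤ ‖v‖ * ‖v‖ * ‖v‖ :=
          (norm_mul_le _ _).trans (mul_le_mul_of_nonneg_right h7 (norm_nonneg _))
        have h9 : ‖v * v * (4 * v - 3)‖ ≤ 4 * ‖v * v * v‖ + 3 * ‖v * v‖ := by
          rw [h6]
          have e1 := norm_sub_le (v * v * v + v * v * v + v * v * v + v * v * v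
            - v * v - v * v) (v * v)
          have e2 := norm_sub_le (v * v * v + v * v * v + v * v * v + v * v * v
            - v * v) (v * v)
          have e3 := norm_sub_le (v * v * v + v * v * v + v * v * v + v * v * v) (v * v)
          have e4 := norm_add_le (v * v * v + v * v * v + v * v * v) (v * v * v)
          have e5 := norm_add_le (v * v * v + v * v * v) (v * v * v)
          have e6 := norm_add_le (v * v * v) (v * v * v)
          linarith
        have h10 := norm_nonneg v
        -- This is where the constant `14` is used: `4‖v‖³ + 3‖v‖² ≤ 7‖v‖² ≤ ‖v‖ / 2`.
        have h11 : ‖v * v * (4 * v - 3)‖ ≤ ‖v‖ / 2 := by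
          have : ‖v‖ * ‖v‖ * ‖v‖ ≤ ‖v‖ * ‖v‖ := by nlinarith [mul_nonneg h10 h10]
          nlinarith
        refine h11.trans ?_
        rw [pow_succ, ← div_div]
        linarith
      have h5 : ‖u (n + 1) - x‖ ≤ 2 * (2 * C + 3) * δ * (1 - 1 / 2 ^ (n + 1)) := by
        have h6 : ‖u (n + 1) - x‖ ≤ ‖u (n + 1) - u n‖ + ‖u n - x‖ :=
          norm_sub_le_norm_sub_add_norm_sub _ _ _
        refine h6.trans ((add_le_add h3 h2).trans_eq ?_)
        rw [pow_succ]
        field_simp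
        ring
      exact ⟨h4, h5, step (n + 1) h4 h5⟩
  have hdist (n : ℕ) : dist (u n) (u (n + 1)) ≤ 2 * (2 * C + 3) * δ / 2 / 2 ^ n := by
    rw [dist_comm, dist_eq_norm]
    refine (key n).2.2.trans_eq ?_
    ring
  obtain ⟨y, hy⟩ := cauchySeq_tendsto_of_complete (cauchySeq_of_le_geometric_two hdist)
  refine ⟨y, ?_, ?_⟩
  · have h1 : Tendsto (fun n => u n * u n - u n) atTop (𝓝 (y * y - y)) := (hy.mul hy).sub hy
    have h2 : Tendsto (fun n => u n * u n - u n) atTop (𝓝 0) := by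
      refine squeeze_zero_norm (fun n => (key n).1) ?_
      have := (tendsto_pow_atTop_nhds_zero_of_lt_one (r := (1 / 2 : ℝ)) (by norm_num)
        (by norm_num)).const_mul δ
      rw [mul_zero] at this
      refine this.congr fun n => ?_
      rw [one_div, inv_pow, div_eq_mul_inv]
    exact sub_eq_zero.1 (tendsto_nhds_unique h1 h2)
  · rw [← dist_eq_norm, dist_comm, ← hu0]
    exact dist_le_of_le_geometric_two_of_tendsto₀ hdist hy

/-! ### Traces of nearby idempotent matrices. -/

namespace Matrix

variable {m n K : Type*} [Fintype m] [Fintype n]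

theorem exists_trace_eq_natCast_of_isIdempotentElem [Field K] [DecidableEq n] {E : Matrix n n K}
    (hE : IsIdempotentElem E) : ∃ k : ℕ, E.trace = k := by
  have h : IsIdempotentElem (Matrix.toLin' E) := by
    have := Matrix.toLin'_mul E E
    rw [hE.eq] at this
    exact this.symm
  have := (LinearMap.IsIdempotentElem.isProj_range _ h).trace
  rw [Matrix.trace_toLin'_eq] at this
  exact ⟨_, this⟩

open scoped Matrix.Norms.Operator

section Norm

variable [NormedField K]

theorem norm_le_of_forall_sum_norm_le {A : Matrix m n K} {c : ℝ} (hc : 0 ≤ c)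
    (h : ∀ i, ∑ j, ‖A i j‖ ≤ c) : ‖A‖ ≤ c := by
  lift c to NNReal using hc
  rw [linfty_opNorm_def]
  refine NNReal.coe_le_coe.2 (Finset.sup_le fun i _ => NNReal.coe_le_coe.1 ?_)
  simpa using h i

theorem sum_norm_le_norm (A : Matrix m n K) (i : m) : ∑ j, ‖A i j‖ ≤ ‖A‖ := by
  rw [linfty_opNorm_def]
  have := Finset.le_sup (f := fun i => ∑ j, ‖A i j‖₊) (Finset.mem_univ i)
  simpa using NNReal.coe_le_coe.2 this

variable [DecidableEq n]

/-- A square matrix over a field is invertible once its kernel is trivial, and a kernel vector of `1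
- A` would satisfy `v = A v`. No Neumann series or completeness is involved. -/
theorem isUnit_one_sub_of_norm_lt_one {A : Matrix n n K} (h : ‖A‖ < 1) : IsUnit (1 - A) := by
  rw [Matrix.isUnit_iff_isUnit_det, isUnit_iff_ne_zero]
  intro h0
  obtain ⟨v, hv, hv0⟩ := exists_mulVec_eq_zero_iff.2 h0
  rw [sub_mulVec, one_mulVec, sub_eq_zero] at hv0
  have h1 : ‖v‖ ≤ ‖A‖ * ‖v‖ := by
    conv_lhs => rw [hv0]
    exact linfty_opNorm_mulVec A v
  have h2 : 0 < ‖v‖ := norm_pos_iff.2 hv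
  nlinarith

/-- Idempotent matrices at distance less than `1` have the same trace. -/
theorem trace_eq_of_norm_sub_lt_one {E F : Matrix n n K} (hE : IsIdempotentElem E)
    (hF : IsIdempotentElem F) (h : ‖E - F‖ < 1) : E.trace = F.trace := by
  -- The standard intertwiner: `E W = W F`, and `W W' = 1 - (E - F)²` is invertible, so `E` and `F`
  -- are conjugate.
  set W := E * F + (1 - E) * (1 - F) with hW
  set W' := F * E + (1 - F) * (1 - E)
  have e1 : E * E = E := hE
  have e2 : F * F = F := hF
  have hWW : W * W' = 1 - (E - F) * (E - F) := by
    have h1 : E * F * (F * E) = E * F * E := by rw [mul_assoc, ← mul_assoc F, e2, mul_assoc]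
    have h2 : E * F * ((1 - F) * (1 - E)) = 0 := by
      have : F * (1 - F) = 0 := by rw [mul_sub, mul_one, e2, sub_self]
      rw [mul_assoc, ← mul_assoc F, this, zero_mul, mul_zero]
    have h3 : (1 - E) * (1 - F) * (F * E) = 0 := by
      have : (1 - F) * F = 0 := by rw [sub_mul, one_mul, e2, sub_self]
      rw [mul_assoc, ← mul_assoc (1 - F), this, zero_mul, mul_zero]
    have h4 : (1 - F) * (1 - F) = 1 - F := hF.one_sub
    have h5 : (1 - E) * (1 - F) * ((1 - F) * (1 - E)) = (1 - E) * (1 - F) * (1 - E) := by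
      rw [mul_assoc, ← mul_assoc (1 - F), h4, mul_assoc]
    have h6 : (1 - E) * (1 - E) = 1 - E := hE.one_sub
    calc W * W' = E * F * (F * E) + E * F * ((1 - F) * (1 - E)) + (1 - E) * (1 - F) * (F * E) +
          (1 - E) * (1 - F) * ((1 - F) * (1 - E)) := by simp only [W, W']; noncomm_ring
      _ = E * F * E + (1 - E) * (1 - F) * (1 - E) := by rw [h1, h2, h3, h5]; abel
      _ = 1 - E - F + F * E + E * F - E * E + E + (E * E - E) := by
          have : (1 - E) * (1 - F) * (1 - E) = (1 - E) * (1 - E) - F + F * E + E * F - E * F * E := by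
            noncomm_ring
          rw [this, h6, e1]
          abel
      _ = _ := by
          have : (E - F) * (E - F) = E * E - E * F - F * E + F * F := by noncomm_ring
          rw [this, e1, e2]
          abel
  have hsq : ‖(E - F) * (E - F)‖ < 1 :=
    (norm_mul_le _ _).trans_lt (mul_lt_one_of_nonneg_of_lt_one_left (norm_nonneg _) h h.le)
  have hu : IsUnit (W * W') := hWW ▸ isUnit_one_sub_of_norm_lt_one hsq
  have hWu : IsUnit W.det := by
    rw [isUnit_iff_isUnit_det, det_mul] at hu
    exact isUnit_of_mul_isUnit_left hu
  have hint : E * W = W * F := by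
    have h1 : E * (1 - E) = 0 := by rw [mul_sub, mul_one, e1, sub_self]
    have h2 : (1 - F) * F = 0 := by rw [sub_mul, one_mul, e2, sub_self]
    rw [hW, mul_add, add_mul, ← mul_assoc, ← mul_assoc, e1, h1, zero_mul, mul_assoc, e2, mul_assoc,
      h2, mul_zero]
  calc E.trace = (E * W * W⁻¹).trace := by rw [mul_assoc, mul_nonsing_inv W hWu, mul_one]
    _ = F.trace := by rw [hint, trace_mul_comm, ← mul_assoc, nonsing_inv_mul W hWu, one_mul]

end Norm

end Matrix

/-! ### The index of an infinite idempotent matrix close to a constant one -/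

namespace InfiniteMatrix

open Matrix Filter Topology
open scoped Matrix.Norms.Operator

variable {K ι J : Type*} [NormedField K] [Fintype ι] [Fintype J] {L : ℕ}

/-- The enumeration of the index pairs `(k, s)` with `k < L`. -/
def initial (e : J ≃ Fin L × ι) (p : J) : ℕ × ι := ((e p).1, (e p).2)

theorem sum_initial {M : Type*} [AddCommMonoid M] (e : J ≃ Fin L × ι) (f : ℕ × ι → M) :
    ∑ p, f (initial e p) = ∑ k ∈ Finset.range L, ∑ s, f (k, s) := by
  rw [← Fin.sum_univ_eq_sum_range (fun k => ∑ s, f (k, s)), ← Fintype.sum_prod_type',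
    ← Equiv.sum_comp e]
  rfl

theorem norm_le_of_forall_norm_le_mul_pow (e : J ≃ Fin L × ι) {r c : ℝ} (hr0 : 0 < r) (hr1 : r < 1)
    (hc : 0 ≤ c) {A : Matrix J J K} (h : ∀ p p', ‖A p p'‖ ≤ c * r ^ (initial e p').1) :
    ‖A‖ ≤ Fintype.card ι * c * (1 - r)⁻¹ := by
  have hr : 0 < 1 - r := sub_pos.2 hr1
  refine norm_le_of_forall_sum_norm_le (by positivity) fun p => ?_
  calc ∑ p', ‖A p p'‖ ≤ ∑ p', c * r ^ (initial e p').1 := Finset.sum_le_sum fun p' _ => h p p'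
    _ = ∑ k ∈ Finset.range L, ∑ _s : ι, c * r ^ k := sum_initial e (fun x => c * r ^ x.1)
    _ = Fintype.card ι * c * ∑ k ∈ Finset.range L, r ^ k := by
        simp only [Finset.sum_const, Finset.card_univ, nsmul_eq_mul, ← Finset.mul_sum, mul_assoc]
    _ ≤ _ := by
        refine mul_le_mul_of_nonneg_left ?_ (by positivity)
        rw [← tsum_geometric_of_lt_one hr0.le hr1]
        exact (summable_geometric_of_lt_one hr0.le hr1).sum_le_tsum _ fun _ _ => by positivity

theorem norm_trace_le (e : J ≃ Fin L × ι) (A : Matrix J J K) :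
    ‖A.trace‖ ≤ L * Fintype.card ι * ‖A‖ := by
  calc ‖A.trace‖ ≤ ∑ p, ‖A p p‖ := norm_sum_le _ _
    _ ≤ ∑ _p : J, ‖A‖ := Finset.sum_le_sum fun p _ =>
        (Finset.single_le_sum (f := fun p' => ‖A p p'‖) (fun _ _ => norm_nonneg _)
          (Finset.mem_univ p)).trans (sum_norm_le_norm A p)
    _ = _ := by
        rw [Finset.sum_const, Finset.card_univ, Fintype.card_congr e, Fintype.card_prod,
          Fintype.card_fin, nsmul_eq_mul, Nat.cast_mul]

variable {N : Matrix (ℕ × ι) (ℕ × ι) K} {e₀ : Matrix ι ι K} {C r : ℝ}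

/-- The matrix `N` is exponentially close to the matrix with constant diagonal blocks `e₀`. -/
def IsExpClose (N : Matrix (ℕ × ι) (ℕ × ι) K) (e₀ : Matrix ι ι K) (C r : ℝ) : Prop :=
  ∀ i s j t, ‖N (i, s) (j, t) - (if i = j then e₀ s t else 0)‖ ≤ C * r ^ (2 * (i + j))

/-- The block-diagonal part has norm at most `‖e₀‖`, and the row sums of the remainder are dominated
by a geometric series. The point is a bound uniform in `L`. -/
theorem IsExpClose.norm_submatrix_le (h : IsExpClose N e₀ C r) (hr0 : 0 < r) (hr1 : r < 1)
    (hC : 0 ≤ C) (e : J ≃ Fin L × ι) :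
    ‖N.submatrix (initial e) (initial e)‖ ≤ ‖e₀‖ + Fintype.card ι * C * (1 - r)⁻¹ := by
  let D : Matrix J J K := Matrix.of fun p p' =>
    if (initial e p).1 = (initial e p').1 then e₀ (initial e p).2 (initial e p').2 else 0
  have hD : ‖D‖ ≤ ‖e₀‖ := by
    refine norm_le_of_forall_sum_norm_le (norm_nonneg _) fun p => ?_
    have h1 : ∑ p', ‖D p p'‖ = ∑ k ∈ Finset.range L, ∑ s,
        ‖if (initial e p).1 = k then e₀ (initial e p).2 s else 0‖ :=
      sum_initial e (fun x => ‖if (initial e p).1 = x.1 then e₀ (initial e p).2 x.2 else 0‖)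
    have h2 (k : ℕ) : (∑ s, ‖if (initial e p).1 = k then e₀ (initial e p).2 s else 0‖) =
        if (initial e p).1 = k then ∑ s, ‖e₀ (initial e p).2 s‖ else 0 := by
      split_ifs <;> simp
    rw [h1, Finset.sum_congr rfl fun k _ => h2 k, Finset.sum_ite_eq]
    split_ifs
    · exact sum_norm_le_norm _ _
    · exact norm_nonneg _
  have hR : ‖N.submatrix (initial e) (initial e) - D‖ ≤ Fintype.card ι * C * (1 - r)⁻¹ := by
    refine norm_le_of_forall_norm_le_mul_pow e hr0 hr1 hC fun p p' => ?_
    refine (h (initial e p).1 (initial e p).2 (initial e p').1 (initial e p').2).trans ?_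
    exact mul_le_mul_of_nonneg_left (pow_le_pow_of_le_one hr0.le hr1.le (by omega)) hC
  calc _ = ‖D + (N.submatrix (initial e) (initial e) - D)‖ := by rw [add_sub_cancel]
    _ ≤ _ := (norm_add_le _ _).trans (add_le_add hD hR)

/-- Squaring the truncation misses only the intermediate indices `k ≥ L`. Each such term is a
product of two off-diagonal entries, so the defect decays like `r ^ L`. -/
theorem IsExpClose.norm_submatrix_mul_self_sub_le (h : IsExpClose N e₀ C r) (hr0 : 0 < r)
    (hr1 : r < 1) (hC : 0 ≤ C)
    (hN : ∀ p p', HasSum (fun k => ∑ u, N p (k, u) * N (k, u) p') (N p p'))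
    (e : J ≃ Fin L × ι) :
    ‖N.submatrix (initial e) (initial e) * N.submatrix (initial e) (initial e) -
        N.submatrix (initial e) (initial e)‖ ≤
      Fintype.card ι * (Fintype.card ι * C ^ 2 * (1 - r)⁻¹ * r ^ L) * (1 - r)⁻¹ := by
  have hr : 0 < 1 - r := sub_pos.2 hr1
  refine norm_le_of_forall_norm_le_mul_pow e hr0 hr1 (by positivity) fun p p' => ?_
  have hp : (initial e p).1 < L := (e p).1.2
  have hp' : (initial e p').1 < L := (e p').1.2
  have h1 : (N.submatrix (initial e) (initial e) * N.submatrix (initial e) (initial e)) p p' =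
      ∑ k ∈ Finset.range L, ∑ u, N (initial e p) (k, u) * N (k, u) (initial e p') := by
    rw [Matrix.mul_apply]
    exact sum_initial e (fun x => N (initial e p) x * N x (initial e p'))
  have h2 := (hasSum_nat_add_iff' L).2 (hN (initial e p) (initial e p'))
  have hoff (i j : ℕ) (s t : ι) (hij : i ≠ j) : ‖N (i, s) (j, t)‖ ≤ C * r ^ (2 * (i + j)) := by
    simpa [hij] using h i s j t
  have h3 (k : ℕ) : ‖∑ u, N (initial e p) (k + L, u) * N (k + L, u) (initial e p')‖ ≤
      Fintype.card ι * C ^ 2 * r ^ L * r ^ (initial e p').1 * r ^ k := by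
    refine (norm_sum_le _ _).trans ?_
    calc ∑ u, ‖N (initial e p) (k + L, u) * N (k + L, u) (initial e p')‖
        ≤ ∑ _u : ι, C ^ 2 * r ^ L * r ^ (initial e p').1 * r ^ k := by
          refine Finset.sum_le_sum fun u _ => ?_
          rw [norm_mul]
          have e1 := hoff (initial e p).1 (k + L) (initial e p).2 u (by omega)
          have e2 := hoff (k + L) (initial e p').1 u (initial e p').2 (by omega)
          refine (mul_le_mul e1 e2 (norm_nonneg _) (by positivity)).trans ?_
          calc C * r ^ (2 * ((initial e p).1 + (k + L))) * (C * r ^ (2 * (k + L + (initial e p').1)))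
              = C ^ 2 * r ^ (2 * ((initial e p).1 + (k + L)) + 2 * (k + L + (initial e p').1)) := by
                rw [pow_add]; ring
            _ ≤ C ^ 2 * r ^ (L + (initial e p').1 + k) :=
                mul_le_mul_of_nonneg_left
                  (pow_le_pow_of_le_one hr0.le hr1.le (by omega)) (by positivity)
            _ = _ := by rw [pow_add, pow_add]; ring
      _ = _ := by
          rw [Finset.sum_const, Finset.card_univ, nsmul_eq_mul]
          ring
  have h4 := h2.norm_le_of_bounded ((hasSum_geometric_of_lt_one hr0.le hr1).mul_left _) h3
  rw [Matrix.sub_apply, h1, norm_sub_rev]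
  refine h4.trans_eq ?_
  ring

/-- The constant `D` serves every truncation length and every index type. The freedom in `J` allows
both `Fin L × ι` and its block extension. -/
theorem IsExpClose.exists_isIdempotentElem_norm_sub_le [CompleteSpace K]
    (h : IsExpClose N e₀ C r) (hr0 : 0 < r) (hr1 : r < 1) (hC : 0 ≤ C)
    (hN : ∀ p p', HasSum (fun k => ∑ u, N p (k, u) * N (k, u) p') (N p p')) :
    ∃ D : ℝ, 0 ≤ D ∧ ∀ (L : ℕ) (J : Type) [Fintype J] [DecidableEq J] (e : J ≃ Fin L × ι),
      D * r ^ L ≤ 1 → ∃ F : Matrix J J K, IsIdempotentElem F ∧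
        ‖F - N.submatrix (initial e) (initial e)‖ ≤ D * r ^ L := by
  have hr : 0 < 1 - r := sub_pos.2 hr1
  set M := ‖e₀‖ + Fintype.card ι * C * (1 - r)⁻¹ with hM
  have hM0 : 0 ≤ M := by positivity
  set b := Fintype.card ι * (Fintype.card ι * C ^ 2 * (1 - r)⁻¹) * (1 - r)⁻¹ with hb
  have hb0 : 0 ≤ b := by positivity
  refine ⟨14 * (2 * M + 3) * b, by positivity, fun L J _ _ e hL => ?_⟩
  have h1 := h.norm_submatrix_le hr0 hr1 hC e
  have h2 := h.norm_submatrix_mul_self_sub_le hr0 hr1 hC hN e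
  have h3 : Fintype.card ι * (Fintype.card ι * C ^ 2 * (1 - r)⁻¹ * r ^ L) * (1 - r)⁻¹ =
      b * r ^ L := by rw [hb]; ring
  rw [h3] at h2
  have : @CompleteSpace (Matrix J J K)
      (Matrix.linftyOpNormedRing (n := J) (α := K)).toPseudoMetricSpace.toUniformSpace := by
    have : CompleteSpace (J → J → K) := inferInstance
    exact this
  obtain ⟨F, hF, hFn⟩ := _root_.exists_isIdempotentElem_norm_sub_le hM0 h1
    ((mul_le_mul_of_nonneg_left h2 (by positivity)).trans (by linarith))
  refine ⟨F, hF, hFn.trans ((mul_le_mul_of_nonneg_left h2 (by positivity)).trans ?_)⟩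
  have : 0 ≤ (2 * M + 3) * (b * r ^ L) := by positivity
  linarith

open scoped Kronecker in
/-- An idempotent matrix that is close to a truncation of `N`, extended by constant diagonal blocks,
is close to the larger truncations of `N`. -/
theorem IsExpClose.norm_fromBlocks_sub_le [DecidableEq ι] (h : IsExpClose N e₀ C r) (hr0 : 0 < r)
    (hr1 : r < 1) (hC : 0 ≤ C) (L d : ℕ) (F : Matrix (Fin L × ι) (Fin L × ι) K)
    (e : (Fin L × ι) ⊕ (Fin d × ι) ≃ Fin (L + d) × ι)
    (he : e = (Equiv.sumProdDistrib (Fin L) (Fin d) ι).symm.trans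
      (finSumFinEquiv.prodCongr (Equiv.refl ι))) :
    ‖Matrix.fromBlocks F 0 0 ((1 : Matrix (Fin d) (Fin d) K) ⊗ₖ e₀) -
        N.submatrix (initial e) (initial e)‖ ≤
      ‖F - N.submatrix (initial (Equiv.refl _)) (initial (Equiv.refl _))‖ +
        Fintype.card ι * (C * r ^ L) * (1 - r)⁻¹ := by
  have hl (p : Fin L × ι) : initial e (Sum.inl p) = ((p.1 : ℕ), p.2) := by rw [he]; rfl
  have hr (p : Fin d × ι) : initial e (Sum.inr p) = (L + (p.1 : ℕ), p.2) := by rw [he]; rfl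
  set F' := F - N.submatrix (initial (Equiv.refl _)) (initial (Equiv.refl _)) with hF'
  have h1 : ‖Matrix.fromBlocks F' 0 0 (0 : Matrix (Fin d × ι) (Fin d × ι) K)‖ ≤ ‖F'‖ := by
    refine norm_le_of_forall_sum_norm_le (norm_nonneg _) fun p => ?_
    rcases p with p | p
    · simpa using sum_norm_le_norm F' p
    · simp
  have h2 : ‖Matrix.fromBlocks F 0 0 ((1 : Matrix (Fin d) (Fin d) K) ⊗ₖ e₀) -
      N.submatrix (initial e) (initial e) -
      Matrix.fromBlocks F' 0 0 (0 : Matrix (Fin d × ι) (Fin d × ι) K)‖ ≤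
      Fintype.card ι * (C * r ^ L) * (1 - r)⁻¹ := by
    refine norm_le_of_forall_norm_le_mul_pow e hr0 hr1 (by positivity) fun p p' => ?_
    have hbound (i j : ℕ) (s t : ι) (hij : L ≤ i ∨ L ≤ j) :
        ‖(if i = j then e₀ s t else 0) - N (i, s) (j, t)‖ ≤ C * r ^ L * r ^ j := by
      rw [norm_sub_rev, mul_assoc, ← pow_add]
      exact (h i s j t).trans (mul_le_mul_of_nonneg_left
        (pow_le_pow_of_le_one hr0.le hr1.le (by omega)) hC)
    rcases p with ⟨i, s⟩ | ⟨i, s⟩ <;> rcases p' with ⟨j, t⟩ | ⟨j, t⟩ <;>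
      simp only [Matrix.sub_apply, Matrix.fromBlocks_apply₁₁, Matrix.fromBlocks_apply₁₂,
        Matrix.fromBlocks_apply₂₁, Matrix.fromBlocks_apply₂₂, Matrix.submatrix_apply, hl, hr,
        Matrix.zero_apply, sub_zero, Matrix.kroneckerMap_apply, Matrix.one_apply]
    · have : F (i, s) (j, t) - N (↑i, s) (↑j, t) - F' (i, s) (j, t) = 0 := sub_self _
      rw [this, norm_zero]
      positivity
    · have := hbound i (L + j) s t (by omega)
      rwa [if_neg (by omega)] at this
    · have := hbound (L + i) j s t (by omega)
      rwa [if_neg (by omega)] at this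
    · have := hbound (L + i) (L + j) s t (by omega)
      have hij : ((L + (i : ℕ) = L + (j : ℕ)) ↔ i = j) := by
        rw [Nat.add_left_cancel_iff, Fin.val_inj]
      simp only [hij] at this
      simpa only [ite_mul, one_mul, zero_mul] using this
  have h3 := (norm_add_le _ _).trans (add_le_add h1 h2)
  rwa [add_sub_cancel] at h3

open scoped Kronecker in
/-- The regularized trace of an infinite idempotent matrix that is exponentially close to a matrix
with constant diagonal blocks is an integer. -/
theorem IsExpClose.exists_hasSum_eq_intCast [CompleteSpace K] {ι : Type} [Fintype ι] [DecidableEq ι]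
    {N : Matrix (ℕ × ι) (ℕ × ι) K} {e₀ : Matrix ι ι K}
    (h : IsExpClose N e₀ C r) (hr0 : 0 < r) (hr1 : r < 1) (hC : 0 ≤ C)
    (he₀ : IsIdempotentElem e₀)
    (hN : ∀ p p', HasSum (fun k => ∑ u, N p (k, u) * N (k, u) p') (N p p')) {T : K}
    (hT : HasSum (fun k => ∑ s, (N (k, s) (k, s) - e₀ s s)) T) : ∃ m : ℤ, T = m := by
  obtain ⟨D, hD0, hD⟩ := h.exists_isIdempotentElem_norm_sub_le hr0 hr1 hC hN
  obtain ⟨r₀, hr₀⟩ := exists_trace_eq_natCast_of_isIdempotentElem he₀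
  have hpow := tendsto_pow_atTop_nhds_zero_of_lt_one hr0.le hr1
  have hr : 0 < 1 - r := sub_pos.2 hr1
  set c := Fintype.card ι * C * (1 - r)⁻¹ with hc
  -- With both quantities below `1/4`, the three errors compared later add up to less than `3/4`.
  obtain ⟨L, hL1, hL2⟩ : ∃ L, D * r ^ L < 1 / 4 ∧ c * r ^ L < 1 / 4 := by
    have h1 := hpow.const_mul D
    have h2 := hpow.const_mul c
    rw [mul_zero] at h1 h2
    exact ((h1.eventually_lt_const (by norm_num)).and (h2.eventually_lt_const (by norm_num))).exists
  obtain ⟨F, hF, hFn⟩ := hD L (Fin L × ι) (Equiv.refl _) (by linarith)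
  obtain ⟨n₀, hn₀⟩ := exists_trace_eq_natCast_of_isIdempotentElem hF
  refine ⟨n₀ - L * r₀, ?_⟩
  -- The idempotents `G` near the truncation at `L + d` and `F ⊕ (1 ⊗ e₀)` are at distance less than
  -- `1`. So `G` has trace `n₀ + d r₀`, and subtracting `(L + d) r₀` leaves an integer independent
  -- of `d`; only the distance from `G` to the truncation remains as error.
  have key (d : ℕ) : ‖∑ k ∈ Finset.range (d + L), ∑ s, (N (k, s) (k, s) - e₀ s s) -
      ((n₀ - L * r₀ : ℤ) : K)‖ ≤ (d + L : ℕ) * Fintype.card ι * (D * r ^ (d + L)) := by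
    rw [add_comm d L]
    obtain ⟨e, he⟩ : ∃ e : (Fin L × ι) ⊕ (Fin d × ι) ≃ Fin (L + d) × ι, e =
      (Equiv.sumProdDistrib (Fin L) (Fin d) ι).symm.trans
        (finSumFinEquiv.prodCongr (Equiv.refl ι)) := ⟨_, rfl⟩
    have hle : D * r ^ (L + d) ≤ D * r ^ L :=
      mul_le_mul_of_nonneg_left (pow_le_pow_of_le_one hr0.le hr1.le (by omega)) hD0
    obtain ⟨G, hG, hGn⟩ := hD (L + d) _ e (by linarith)
    have hH : IsIdempotentElem (Matrix.fromBlocks F 0 0 ((1 : Matrix (Fin d) (Fin d) K) ⊗ₖ e₀)) := by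
      rw [IsIdempotentElem, Matrix.fromBlocks_multiply]
      simp only [Matrix.zero_mul, Matrix.mul_zero, add_zero, zero_add, hF.eq,
        ← Matrix.mul_kronecker_mul, he₀.eq, mul_one]
    have h1 := h.norm_fromBlocks_sub_le hr0 hr1 hC L d F e he
    have h2 : Fintype.card ι * (C * r ^ L) * (1 - r)⁻¹ = c * r ^ L := by rw [hc]; ring
    rw [h2] at h1
    have h3 : ‖G - Matrix.fromBlocks F 0 0 ((1 : Matrix (Fin d) (Fin d) K) ⊗ₖ e₀)‖ < 1 := by
      have := norm_sub_le (G - N.submatrix (initial e) (initial e))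
        (Matrix.fromBlocks F 0 0 ((1 : Matrix (Fin d) (Fin d) K) ⊗ₖ e₀) -
          N.submatrix (initial e) (initial e))
      rw [sub_sub_sub_cancel_right] at this
      linarith
    have h4 := trace_eq_of_norm_sub_lt_one hG hH h3
    have htr (A : Matrix (Fin L × ι) (Fin L × ι) K) (B : Matrix (Fin d × ι) (Fin d × ι) K) :
        (Matrix.fromBlocks A 0 0 B).trace = A.trace + B.trace := by
      simp [Matrix.trace, Fintype.sum_sum_type]
    rw [htr, hn₀, Matrix.trace_kronecker, hr₀, Matrix.trace_one,
      Fintype.card_fin] at h4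
    have h5 : (N.submatrix (initial e) (initial e)).trace =
        ∑ k ∈ Finset.range (L + d), ∑ s, N (k, s) (k, s) := sum_initial e (fun x => N x x)
    have h6 : ∑ k ∈ Finset.range (L + d), ∑ s, (N (k, s) (k, s) - e₀ s s) -
        ((n₀ - L * r₀ : ℤ) : K) = -(G - N.submatrix (initial e) (initial e)).trace := by
      have h7 : ∑ s, e₀ s s = r₀ := hr₀
      simp only [Finset.sum_sub_distrib, Finset.sum_const, Finset.card_range, h7, Matrix.trace_sub,
        h4, h5, nsmul_eq_mul]
      push_cast
      ring
    rw [h6, norm_neg]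
    refine (norm_trace_le e _).trans ?_
    exact mul_le_mul_of_nonneg_left hGn (by positivity)
  have h1 : Tendsto (fun d => ∑ k ∈ Finset.range (d + L), ∑ s, (N (k, s) (k, s) - e₀ s s)) atTop
      (𝓝 T) := (tendsto_add_atTop_iff_nat L).2 hT.tendsto_sum_nat
  have h2 : Tendsto (fun d : ℕ => ((d + L : ℕ) : ℝ) * Fintype.card ι * (D * r ^ (d + L))) atTop
      (𝓝 0) := by
    have h3 := (tendsto_self_mul_const_pow_of_lt_one hr0.le hr1).const_mul (Fintype.card ι * D)
    rw [mul_zero] at h3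
    refine ((tendsto_add_atTop_iff_nat L).2 h3).congr fun d => ?_
    ring
  have h3 := squeeze_zero_norm key h2
  exact tendsto_nhds_unique h1 (tendsto_sub_nhds_zero_iff.1 h3)

end InfiniteMatrix

/-! ### Matrix coefficients of operators on finitely supported sequences -/

namespace SeqOp

variable {K : Type} [NormedField K]

/-- The matrix coefficient `(i, j)` of an operator on finitely supported sequences. -/
def coef (T : Module.End K (ℕ →₀ K)) (i j : ℕ) : K := T (Finsupp.single j 1) i

/-- Columns are finitely supported, so the sum over `k` is in fact finite. -/
theorem hasSum_coef_mul (S T : Module.End K (ℕ →₀ K)) (i j : ℕ) :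
    HasSum (fun k => coef S i k * coef T k j) (coef (S * T) i j) := by
  have h : coef (S * T) i j = ∑ k ∈ (T (Finsupp.single j 1)).support, coef S i k * coef T k j := by
    have h1 : T (Finsupp.single j 1) = ∑ k ∈ (T (Finsupp.single j 1)).support,
        coef T k j • Finsupp.single k (1 : K) := by
      conv_lhs => rw [← Finsupp.sum_single (T (Finsupp.single j 1))]
      refine Finset.sum_congr rfl fun k _ => ?_
      rw [Finsupp.smul_single, smul_eq_mul, mul_one]
      rfl
    rw [coef, Module.End.mul_apply]
    conv_lhs => rw [h1]
    rw [map_sum, Finsupp.finsetSum_apply]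
    refine Finset.sum_congr rfl fun k _ => ?_
    rw [map_smul, Finsupp.smul_apply, smul_eq_mul, mul_comm]
    rfl
  rw [h]
  refine hasSum_sum_of_ne_finset_zero fun k hk => ?_
  have : coef T k j = 0 := Finsupp.notMem_support_iff.1 hk
  rw [this, mul_zero]

/-- `T` differs from the scalar `t` by a matrix with exponentially decaying coefficients. -/
def IsExpScalar (r : ℝ) (T : Module.End K (ℕ →₀ K)) (t : K) : Prop :=
  ∃ C : ℝ, 0 ≤ C ∧ ∀ i j, ‖coef T i j - (if i = j then t else 0)‖ ≤ C * r ^ (2 * (i + j))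

variable {r : ℝ} {S T : Module.End K (ℕ →₀ K)} {s t : K}

theorem isExpScalar_algebraMap (r : ℝ) (t : K) :
    IsExpScalar r (algebraMap K (Module.End K (ℕ →₀ K)) t) t := by
  refine ⟨0, le_rfl, fun i j => ?_⟩
  simp [coef, Finsupp.single_apply, eq_comm]

theorem IsExpScalar.add (hS : IsExpScalar r S s) (hT : IsExpScalar r T t) :
    IsExpScalar r (S + T) (s + t) := by
  obtain ⟨C, hC, h⟩ := hS
  obtain ⟨D, hD, h'⟩ := hT
  refine ⟨C + D, add_nonneg hC hD, fun i j => ?_⟩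
  have e : coef (S + T) i j - (if i = j then s + t else 0) =
      (coef S i j - (if i = j then s else 0)) + (coef T i j - (if i = j then t else 0)) := by
    simp only [coef, LinearMap.add_apply, Finsupp.add_apply]
    split_ifs <;> ring
  rw [e, add_mul]
  exact (norm_add_le _ _).trans (add_le_add (h i j) (h' i j))

/-- `ST - st = (S - s)(T - t) + s(T - t) + t(S - s)`. The coefficients of the first product are
bounded by a geometric series in the intermediate index. -/
theorem IsExpScalar.mul (hr0 : 0 < r) (hr1 : r < 1) (hS : IsExpScalar r S s)
    (hT : IsExpScalar r T t) : IsExpScalar r (S * T) (s * t) := by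
  obtain ⟨C, hC, h⟩ := hS
  obtain ⟨D, hD, h'⟩ := hT
  have hr : 0 < 1 - r := sub_pos.2 hr1
  refine ⟨C * D * (1 - r)⁻¹ + ‖s‖ * D + ‖t‖ * C, by positivity, fun i j => ?_⟩
  have h1 := hasSum_coef_mul S T i j
  have h2 : HasSum (fun k => (if i = k then s else 0) * coef T k j) (s * coef T i j) := by
    have := hasSum_single (f := fun k => (if i = k then s else 0) * coef T k j) i
      (fun k hk => by simp [hk.symm])
    simpa using this
  have h3 : HasSum (fun k => coef S i k * (if k = j then t else 0)) (coef S i j * t) := by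
    have := hasSum_single (f := fun k => coef S i k * (if k = j then t else 0)) j
      (fun k hk => by simp [hk])
    simpa using this
  have h4 : HasSum (fun k => (if i = k then s else 0) * (if k = j then t else 0))
      (s * if i = j then t else 0) := by
    have := hasSum_single (f := fun k => (if i = k then s else 0) * (if k = j then t else 0)) i
      (fun k hk => by simp [hk.symm])
    simpa using this
  have h5 := ((h1.sub h2).sub h3).add h4
  have h6 (k : ℕ) : ‖coef S i k * coef T k j - (if i = k then s else 0) * coef T k j -
      coef S i k * (if k = j then t else 0) +
      (if i = k then s else 0) * (if k = j then t else 0)‖ ≤ C * D * r ^ (2 * (i + j)) * r ^ k := by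
    have e : coef S i k * coef T k j - (if i = k then s else 0) * coef T k j -
        coef S i k * (if k = j then t else 0) + (if i = k then s else 0) * (if k = j then t else 0) =
        (coef S i k - (if i = k then s else 0)) * (coef T k j - (if k = j then t else 0)) := by ring
    rw [e, norm_mul]
    refine (mul_le_mul (h i k) (h' k j) (norm_nonneg _) (by positivity)).trans ?_
    calc C * r ^ (2 * (i + k)) * (D * r ^ (2 * (k + j)))
        = C * D * r ^ (2 * (i + j) + 4 * k) := by ring
      _ ≤ C * D * r ^ (2 * (i + j) + k) := mul_le_mul_of_nonneg_left
          (pow_le_pow_of_le_one hr0.le hr1.le (by omega)) (by positivity)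
      _ = _ := by rw [pow_add]; ring
  have h7 := h5.norm_le_of_bounded ((hasSum_geometric_of_lt_one hr0.le hr1).mul_left _) h6
  have h8 : ‖s * (coef T i j - (if i = j then t else 0))‖ ≤ ‖s‖ * (D * r ^ (2 * (i + j))) := by
    rw [norm_mul]
    exact mul_le_mul_of_nonneg_left (h' i j) (norm_nonneg _)
  have h9 : ‖t * (coef S i j - (if i = j then s else 0))‖ ≤ ‖t‖ * (C * r ^ (2 * (i + j))) := by
    rw [norm_mul]
    exact mul_le_mul_of_nonneg_left (h i j) (norm_nonneg _)
  have e : coef (S * T) i j - (if i = j then s * t else 0) =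
      (coef (S * T) i j - s * coef T i j - coef S i j * t + s * (if i = j then t else 0)) +
      s * (coef T i j - (if i = j then t else 0)) + t * (coef S i j - (if i = j then s else 0)) := by
    split_ifs <;> ring
  rw [e]
  refine (norm_add₃_le).trans ((add_le_add (add_le_add h7 h8) h9).trans_eq ?_)
  ring

end SeqOp

/-! ### The representation on sequences, and `τ¹` as a regularized trace. -/

namespace QSphere

open SeqOp

variable {q : ℂ} {K : Type} [NormedField K] [Algebra ℂ K]

/-- The action of the generators of `A(SL_q(2))` on finitely supported sequences:
`a eₖ = eₖ₊₁`, `b eₖ = -qᵏ⁺¹ eₖ`, `c eₖ = qᵏ eₖ` and `d eₖ = (1 - q²ᵏ) eₖ₋₁`. -/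
def unilateralGen (K : Type) [NormedField K] [Algebra ℂ K] (q : ℂ) : Gen → Module.End K (ℕ →₀ K)
  | .a => Finsupp.linearCombination K fun k => Finsupp.single (k + 1) 1
  | .b => Finsupp.linearCombination K fun k => Finsupp.single k (-algebraMap ℂ K q ^ (k + 1))
  | .c => Finsupp.linearCombination K fun k => Finsupp.single k (algebraMap ℂ K q ^ k)
  | .d => Finsupp.linearCombination K fun k =>
      Finsupp.single (k - 1) (1 - algebraMap ℂ K q ^ (2 * k))

section Apply

variable (k : ℕ) (x : K)

theorem unilateralGen_a : unilateralGen K q .a (Finsupp.single k x) = Finsupp.single (k + 1) x := by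
  simp [unilateralGen]

theorem unilateralGen_b : unilateralGen K q .b (Finsupp.single k x) =
    Finsupp.single k (x * -algebraMap ℂ K q ^ (k + 1)) := by
  simp [unilateralGen]

theorem unilateralGen_c : unilateralGen K q .c (Finsupp.single k x) =
    Finsupp.single k (x * algebraMap ℂ K q ^ k) := by
  simp [unilateralGen]

theorem unilateralGen_d : unilateralGen K q .d (Finsupp.single k x) =
    Finsupp.single (k - 1) (x * (1 - algebraMap ℂ K q ^ (2 * k))) := by
  rw [unilateralGen, Finsupp.linearCombination_single, Finsupp.smul_single, smul_eq_mul]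

end Apply

theorem isRep_unilateralGen (hq : q ≠ 0) : IsRep q (unilateralGen K q) := by
  have hQ : algebraMap ℂ K q ≠ 0 := (map_ne_zero _).2 hq
  constructor <;> refine Finsupp.lhom_ext fun k x => ?_ <;>
    simp only [Module.End.mul_apply, LinearMap.smul_apply, LinearMap.sub_apply,
      Module.End.one_apply, unilateralGen_a, unilateralGen_b, unilateralGen_c, unilateralGen_d, Finsupp.smul_single,
      Nat.add_sub_cancel] <;>
    try simp only [Algebra.smul_def (A := K), map_inv₀, map_sub]
  all_goals
    -- At `k = 0` the truncated index `k - 1` is harmless, since the coefficient `1 - q ^ (2 * k)`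
    -- of `d` vanishes.
    rcases k with _ | k <;>
    (try simp only [mul_zero, pow_zero, sub_self, zero_mul, Finsupp.single_zero, Nat.add_sub_cancel,
      zero_add, ← Finsupp.single_sub, zero_sub, ← Finsupp.single_neg]) <;>
    congr 1 <;> field_simp <;> ring

/-- The representation of `A(SL_q(2))` on finitely supported sequences. -/
def unilateralRep (K : Type) [NormedField K] [Algebra ℂ K] (hq : q ≠ 0) :
    SL q →ₐ[ℂ] Module.End K (ℕ →₀ K) :=
  lift q (unilateralGen K q) (isRep_unilateralGen hq)

section

variable (hq : q ≠ 0) (k : ℕ) (x : K)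

theorem unilateralRep_ab : unilateralRep K hq (elemAB hq) (Finsupp.single k x) =
    Finsupp.single (k + 1) (x * -algebraMap ℂ K q ^ (k + 1)) := by
  simp only [unilateralRep, elemAB, map_mul, lift_gen, Module.End.mul_apply, unilateralGen_a,
    unilateralGen_b]

theorem unilateralRep_cd : unilateralRep K hq (elemCD hq) (Finsupp.single k x) =
    Finsupp.single (k - 1)
      (x * (1 - algebraMap ℂ K q ^ (2 * k)) * algebraMap ℂ K q ^ (k - 1)) := by
  simp only [unilateralRep, elemCD, map_mul, lift_gen, Module.End.mul_apply, unilateralGen_c,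
    unilateralGen_d]

theorem unilateralRep_zeta : unilateralRep K hq (elemZeta hq) (Finsupp.single k x) =
    Finsupp.single k (x * algebraMap ℂ K q ^ (2 * k)) := by
  have hQ : algebraMap ℂ K q ≠ 0 := (map_ne_zero _).2 hq
  simp only [unilateralRep, elemZeta, map_mul, map_smul, lift_gen, Module.End.mul_apply,
    LinearMap.smul_apply, unilateralGen_b, unilateralGen_c, Finsupp.smul_single]
  rw [Algebra.smul_def, map_neg, map_inv₀]
  congr 1
  field_simp
  ring

theorem unilateralRep_ab_pow (m : ℕ) :
    ∃ y, (unilateralRep K hq (elemAB hq) ^ m) (Finsupp.single k x) = Finsupp.single (k + m) y := by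
  induction m with
  | zero => exact ⟨x, rfl⟩
  | succ m ih =>
    obtain ⟨y, hy⟩ := ih
    exact ⟨_, by rw [pow_succ', Module.End.mul_apply, hy, unilateralRep_ab]; rfl⟩

theorem unilateralRep_cd_pow (m : ℕ) : ∃ y, (k < m → y = 0) ∧
    (unilateralRep K hq (elemCD hq) ^ m) (Finsupp.single k x) = Finsupp.single (k - m) y := by
  induction m with
  | zero => exact ⟨x, fun h => absurd h (Nat.not_lt_zero _), rfl⟩
  | succ m ih =>
    obtain ⟨y, h0, hy⟩ := ih
    refine ⟨_, fun hk => ?_, by rw [pow_succ', Module.End.mul_apply, hy, unilateralRep_cd]; rfl⟩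
    rcases (Nat.lt_succ_iff.1 hk).lt_or_eq with hk | rfl
    · simp [h0 hk]
    · simp

theorem unilateralRep_zeta_pow (n : ℕ) :
    (unilateralRep K hq (elemZeta hq) ^ n) (Finsupp.single k x) =
      Finsupp.single k (x * (algebraMap ℂ K q ^ (2 * n)) ^ k) := by
  induction n with
  | zero => simp
  | succ n ih =>
    rw [pow_succ', Module.End.mul_apply, ih, unilateralRep_zeta]
    congr 1
    ring

end

section

variable (hq : q ≠ 0)

theorem counit_elemAB : counit q (elemAB hq) = 0 := by
  simp [elemAB, counit, counitGen]

theorem counit_elemCD : counit q (elemCD hq) = 0 := by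
  simp [elemCD, counit, counitGen]

theorem counit_elemZeta : counit q (elemZeta hq) = 0 := by
  simp [elemZeta, counit, counitGen]

end

/-- Operators of this kind form an algebra, so the three generators suffice. Their entries lie
within one step of the diagonal, where `r ^ (2 * (i + j))` is comparable to `r ^ (4 * j)`; this
explains the normalization `‖q‖ = r ^ 4`. -/
theorem isExpScalar_unilateralRep (hq : q ≠ 0) {r : ℝ} (hr0 : 0 < r) (hr1 : r < 1)
    (hr : ‖algebraMap ℂ K q‖ = r ^ 4) (x : sphere q hq) :
    IsExpScalar r (unilateralRep K hq x) (algebraMap ℂ K (counit q x)) := by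
  have key {T : Module.End K (ℕ →₀ K)} {C : ℝ} {f : ℕ → ℕ} {y : ℕ → K} (hC : 0 ≤ C)
      (hT : ∀ j, T (Finsupp.single j 1) = Finsupp.single (f j) (y j))
      (hy : ∀ j, ‖y j‖ ≤ C * r ^ (2 * (f j + j))) : IsExpScalar r T 0 := by
    refine ⟨C, hC, fun i j => ?_⟩
    rw [ite_self, sub_zero, coef, hT, Finsupp.single_apply]
    split_ifs with h
    · exact h ▸ hy j
    · rw [norm_zero]
      positivity
  have hle {m n : ℕ} (h : n ≤ m) : r ^ m ≤ r ^ n := pow_le_pow_of_le_one hr0.le hr1.le h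
  have hx : x ∈ Algebra.adjoin ℂ {elemAB hq, elemCD hq, elemZeta hq} := by
    rw [adjoin_sphere]
    trivial
  induction hx using Algebra.adjoin_induction with
  | mem x hx =>
    rcases hx with rfl | rfl | rfl
    · rw [counit_elemAB, map_zero]
      refine key zero_le_one (fun j => unilateralRep_ab hq j 1) fun j => ?_
      rw [one_mul, norm_neg, norm_pow, hr, ← pow_mul, one_mul]
      exact hle (by omega)
    · rw [counit_elemCD, map_zero]
      -- The entry of `cd` from index `j + 1` to `j` is at most `2 r ^ (4 * j)`, while the required
      -- decay is `r ^ (4 * j + 2)`.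
      refine key (C := 2 * (r⁻¹) ^ 2) (by positivity) (fun j => unilateralRep_cd hq j 1) fun j => ?_
      rcases j with _ | j
      · rw [mul_zero, pow_zero, sub_self, mul_zero, zero_mul, norm_zero]
        positivity
      · have h2 : ‖1 - algebraMap ℂ K q ^ (2 * (j + 1))‖ ≤ 2 := by
          refine (norm_sub_le _ _).trans ?_
          rw [norm_one, norm_pow, hr, ← pow_mul]
          linarith [pow_le_one₀ hr0.le hr1.le (n := 4 * (2 * (j + 1)))]
        rw [one_mul, norm_mul, norm_pow, hr, ← pow_mul, Nat.add_sub_cancel]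
        refine (mul_le_mul_of_nonneg_right h2 (by positivity)).trans_eq ?_
        field_simp
        ring
    · rw [counit_elemZeta, map_zero]
      refine key zero_le_one (fun j => unilateralRep_zeta hq j 1) fun j => ?_
      rw [one_mul, norm_pow, hr, ← pow_mul, one_mul]
      exact hle (by omega)
  | algebraMap t =>
    have := isExpScalar_algebraMap (K := K) r (algebraMap ℂ K t)
    convert this using 1
    · rw [Subalgebra.coe_algebraMap, AlgHom.commutes]
      ext
      simp [Algebra.smul_def, Finsupp.single_apply]
    · rw [Subalgebra.coe_algebraMap, AlgHom.commutes]
      rfl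
  | add x y _ _ hx hy =>
    rw [Subalgebra.coe_add, map_add, map_add, map_add]
    exact hx.add hy
  | mul x y _ _ hx hy =>
    rw [Subalgebra.coe_mul, map_mul, map_mul, map_mul]
    exact hx.mul hr0 hr1 hy

theorem coef_smul (t : ℂ) (T : Module.End K (ℕ →₀ K)) (i j : ℕ) :
    coef (t • T) i j = algebraMap ℂ K t * coef T i j := by
  rw [coef, LinearMap.smul_apply, Finsupp.smul_apply, Algebra.smul_def]
  rfl

/-- On `ζⁿ` with `n > 0` the sum is the geometric series of `q²ⁿ`. On `1` all terms vanish, in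
agreement with `τ¹(1) = 0`, and positive powers of `ab` and `cd` shift the index, so they have zero
diagonal. -/
theorem IsChernTrace.hasSum_unilateralRep {hq : q ≠ 0} {τ : sphere q hq →ₗ[ℂ] ℂ}
    (h : IsChernTrace hq τ) (hlt : ‖algebraMap ℂ K q‖ < 1) (x : sphere q hq) :
    HasSum (fun k => coef (unilateralRep K hq x) k k - algebraMap ℂ K (counit q x))
      (algebraMap ℂ K (τ x)) := by
  have hx : x ∈ Submodule.span ℂ (sphereMonomials hq) := by
    rw [span_sphereMonomials]
    trivial
  have hzero {x : sphere q hq} (h0 : τ x = 0) (hε : counit q x = 0)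
      (hρ : ∀ k, coef (unilateralRep K hq x) k k = 0) :
      HasSum (fun k => coef (unilateralRep K hq x) k k - algebraMap ℂ K (counit q x))
        (algebraMap ℂ K (τ x)) := by
    simp only [h0, hε, hρ, map_zero, sub_zero]
    exact hasSum_zero
  have hpow (n : ℕ) :
      HasSum (fun k => coef (unilateralRep K hq ((elemZeta hq ^ n : sphere q hq) : SL q)) k k -
        algebraMap ℂ K (counit q ((elemZeta hq ^ n : sphere q hq) : SL q)))
        (algebraMap ℂ K (τ (elemZeta hq ^ n))) := by
    have hc (k : ℕ) : coef (unilateralRep K hq ((elemZeta hq ^ n : sphere q hq) : SL q)) k k =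
        (algebraMap ℂ K q ^ (2 * n)) ^ k := by
      rw [coef, Subalgebra.coe_pow, map_pow, unilateralRep_zeta_pow, one_mul,
        Finsupp.single_eq_same]
    have hε : counit q ((elemZeta hq ^ n : sphere q hq) : SL q) = 0 ^ n := by
      rw [Subalgebra.coe_pow, map_pow, counit_elemZeta]
    simp_rw [hc, hε, h.apply_zeta_pow]
    rcases n with _ | n
    · simp [hasSum_zero]
    · rw [zero_pow (Nat.succ_ne_zero n), map_zero, map_inv₀, map_sub, map_one, map_pow]
      simp only [sub_zero]
      refine hasSum_geometric_of_norm_lt_one ?_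
      rw [norm_pow]
      exact pow_lt_one₀ (norm_nonneg _) hlt (by omega)
  induction hx using Submodule.span_induction with
  | mem x hx =>
    rcases hx with ⟨⟨m, n⟩, rfl⟩ | ⟨⟨m, n⟩, rfl⟩
    · rcases m with _ | m
      · simpa only [pow_zero, one_mul] using hpow n
      · refine hzero (h.apply_ab_pow_succ m n) ?_ fun k => ?_
        · simp [counit_elemAB]
        · simp only [coef, Subalgebra.coe_mul, Subalgebra.coe_pow, map_mul, map_pow,
            Module.End.mul_apply, unilateralRep_zeta_pow]
          obtain ⟨y, hy⟩ := unilateralRep_ab_pow hq k (1 * (algebraMap ℂ K q ^ (2 * n)) ^ k) (m + 1)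
          rw [hy, Finsupp.single_eq_of_ne (by omega)]
    · rcases m with _ | m
      · simpa only [pow_zero, one_mul] using hpow n
      · refine hzero (h.apply_cd_pow_succ m n) ?_ fun k => ?_
        · simp [counit_elemCD]
        · simp only [coef, Subalgebra.coe_mul, Subalgebra.coe_pow, map_mul, map_pow,
            Module.End.mul_apply, unilateralRep_zeta_pow]
          obtain ⟨y, h0, hy⟩ :=
            unilateralRep_cd_pow hq k (1 * (algebraMap ℂ K q ^ (2 * n)) ^ k) (m + 1)
          rw [hy]
          by_cases hk : k < m + 1
          · rw [h0 hk, Finsupp.single_zero, Finsupp.zero_apply]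
          · exact Finsupp.single_eq_of_ne (by omega)
  | zero => exact hzero (map_zero _) (map_zero _) fun k => by simp [coef]
  | add x y _ _ hx hy =>
    convert hx.add hy using 1
    · funext k
      simp only [coef, Subalgebra.coe_add, map_add, LinearMap.add_apply, Finsupp.add_apply]
      ring
    · rw [map_add, map_add]
  | smul t x _ hx =>
    simp only [Subalgebra.coe_smul, map_smul, coef_smul, smul_eq_mul, map_mul, ← mul_sub]
    exact hx.mul_left _

theorem IsChernTrace.exists_trace_eq_intCast {hq : q ≠ 0} {τ : sphere q hq →ₗ[ℂ] ℂ}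
    (h : IsChernTrace hq τ) (hroot : ∀ n : ℕ, 0 < n → q ^ n ≠ 1) {n : ℕ}
    {e : Matrix (Fin n) (Fin n) (sphere q hq)} (he : IsIdempotentElem e) :
    ∃ m : ℤ, τ e.trace = m := by
  obtain ⟨K, _, _, φ, hφ⟩ := exists_complete_normedField_norm_lt_one hq hroot
  let _ := φ.toAlgebra
  have hlt : ‖algebraMap ℂ K q‖ < 1 := hφ
  have hpos : 0 < ‖algebraMap ℂ K q‖ := norm_pos_iff.2 ((map_ne_zero _).2 hq)
  obtain ⟨r, hr0, hr1, hr⟩ : ∃ r : ℝ, 0 < r ∧ r < 1 ∧ ‖algebraMap ℂ K q‖ = r ^ 4 := by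
    -- A fourth root of the norm of `q`.
    refine ⟨√√‖algebraMap ℂ K q‖, by positivity, ?_, ?_⟩
    · rw [Real.sqrt_lt' one_pos, one_pow, Real.sqrt_lt' one_pos, one_pow]
      exact hlt
    · rw [show 4 = 2 * 2 from rfl, pow_mul, Real.sq_sqrt (by positivity), Real.sq_sqrt hpos.le]
  have hent (s t : Fin n) : e s t = ∑ u, e s u * e u t := by
    rw [← Matrix.mul_apply, he.eq]
  choose C hC hbound using fun s t => isExpScalar_unilateralRep hq hr0 hr1 hr (e s t)
  have hclose : InfiniteMatrix.IsExpClose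
      (fun p p' : ℕ × Fin n => coef (unilateralRep K hq (e p.2 p'.2)) p.1 p'.1)
      (((algebraMap ℂ K).comp ((counit q).comp (sphere q hq).val).toRingHom).mapMatrix e)
      (∑ s, ∑ t, C s t) r := by
    intro i s j t
    refine (hbound s t i j).trans (mul_le_mul_of_nonneg_right ?_ (by positivity))
    exact (Finset.single_le_sum (fun t _ => hC s t) (Finset.mem_univ t)).trans
      (Finset.single_le_sum (f := fun s => ∑ t, C s t)
        (fun s _ => Finset.sum_nonneg fun t _ => hC s t) (Finset.mem_univ s))
  have hmul (p p' : ℕ × Fin n) :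
      HasSum (fun k => ∑ u, coef (unilateralRep K hq (e p.2 u)) p.1 k *
        coef (unilateralRep K hq (e u p'.2)) k p'.1)
        (coef (unilateralRep K hq (e p.2 p'.2)) p.1 p'.1) := by
    have hsum := hasSum_sum (s := Finset.univ) fun u _ => hasSum_coef_mul
      (unilateralRep K hq (e p.2 u)) (unilateralRep K hq (e u p'.2)) p.1 p'.1
    convert hsum using 1
    conv_lhs => rw [hent p.2 p'.2]
    simp [coef, map_sum, map_mul, LinearMap.sum_apply, Finsupp.finsetSum_apply]
  obtain ⟨m, hm⟩ := hclose.exists_hasSum_eq_intCast hr0 hr1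
    (Finset.sum_nonneg fun s _ => Finset.sum_nonneg fun t _ => hC s t) (he.map _) hmul
    (hasSum_sum (s := Finset.univ) fun s _ => h.hasSum_unilateralRep hlt (e s s))
  -- The equality with an integer holds in `K` and descends to `ℂ` along the embedding.
  refine ⟨m, (algebraMap ℂ K).injective ?_⟩
  rw [Matrix.trace, map_sum, map_sum, map_intCast]
  exact hm

/-- The counit is an algebra map, so it sends `e` to a complex idempotent matrix, whose trace is its
rank. -/
theorem exists_tau0_trace_eq_intCast (hq : q ≠ 0) {n : ℕ}
    {e : Matrix (Fin n) (Fin n) (sphere q hq)} (he : IsIdempotentElem e) :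
    ∃ m : ℤ, tau0 hq e.trace = m := by
  obtain ⟨k, hk⟩ := Matrix.exists_trace_eq_natCast_of_isIdempotentElem
    (he.map ((counit q).comp (sphere q hq).val).toRingHom.mapMatrix)
  refine ⟨k, ?_⟩
  rw [Int.cast_natCast, ← hk]
  simp [Matrix.trace, tau0, map_sum]

end QSphere

/-! ### The pairing of traces with `K₀`. -/

namespace AlgK0

variable {R : Type} [Ring R]

theorem add_nsmul_mem_positiveCone {x y : K0 R} (hx : x ∈ positiveCone R) (hy : y ∈ positiveCone R)
    (m : ℕ) : x + m • y ∈ positiveCone R := by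
  obtain ⟨v, rfl⟩ := hx
  obtain ⟨w, rfl⟩ := hy
  exact ⟨v + m • w, by rw [map_add, map_nsmul]⟩

theorem cls_mem_positiveCone {n : ℕ} (e : Matrix (Fin n) (Fin n) R) (he : IsIdempotentElem e) :
    cls e he ∈ positiveCone R := ⟨_, rfl⟩

variable [Algebra ℂ R] {τ : R →ₗ[ℂ] ℂ}

theorem IsTrace.apply_trace_eq_of_equivalent (h : IsTrace τ) {m n : Type} [Fintype m] [Fintype n]
    {e : Matrix m m R} {f : Matrix n n R} (hef : Equivalent e f) : τ e.trace = τ f.trace := by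
  obtain ⟨u, v, rfl, rfl⟩ := hef
  simp only [Matrix.trace, Matrix.diag_apply, Matrix.mul_apply, map_sum]
  rw [Finset.sum_comm]
  exact Finset.sum_congr rfl fun i _ => Finset.sum_congr rfl fun j _ => h _ _

/-- The additive map `V(R) → ℂ`, `[e] ↦ τ (Tr e)`, induced by a trace `τ`. -/
def traceV (h : IsTrace τ) : V R →+ ℂ where
  toFun := Quotient.lift (fun e : Idem R => τ e.mat.trace)
    fun _ _ hef => h.apply_trace_eq_of_equivalent hef
  map_zero' := (congrArg τ (Matrix.trace_fin_zero _)).trans (map_zero τ)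
  map_add' := by
    rintro ⟨e⟩ ⟨f⟩
    refine (h.apply_trace_eq_of_equivalent (Idem.add_equivalent e f)).symm.trans ?_
    rw [block, Matrix.trace, Fintype.sum_sum_type, map_add]
    rfl

/-- The homomorphism `K₀(R) → ℤ` induced by a trace with integral values on idempotents. -/
def tracePairing (h : IsTrace τ) (hint : ∀ v : V R, ∃ m : ℤ, traceV h v = m) : K0 R →+ ℤ :=
  Algebra.GrothendieckAddGroup.lift
    { toFun := fun v => (hint v).choose
      map_zero' := Int.cast_injective (α := ℂ) (by
        rw [← (hint 0).choose_spec, map_zero, Int.cast_zero])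
      map_add' := fun v w => Int.cast_injective (α := ℂ) (by
        rw [Int.cast_add, ← (hint (v + w)).choose_spec, ← (hint v).choose_spec,
          ← (hint w).choose_spec, map_add]) }

theorem tracePairing_cls (h : IsTrace τ) (hint : ∀ v : V R, ∃ m : ℤ, traceV h v = m) {n : ℕ}
    (e : Matrix (Fin n) (Fin n) R) (he : IsIdempotentElem e) :
    (tracePairing h hint (cls e he) : ℂ) = τ e.trace := by
  refine (congrArg (Int.cast : ℤ → ℂ) (DFunLike.congr_fun
    (Algebra.GrothendieckAddGroup.lift.symm_apply_apply _) _)).trans ?_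
  exact (hint _).choose_spec.symm

end AlgK0

theorem corollary2p4 (q : ℂ) (hq : q ≠ 0) (hroot : ∀ n : ℕ, 0 < n → q ^ n ≠ 1) :
    ∃ τ₁ : QSphere.sphere q hq →ₗ[ℂ] ℂ,
      -- the formula for `τ¹` defines exactly one functional, and `τ⁰`, `τ¹` are traces
      (QSphere.IsChernTrace hq τ₁ ∧ ∀ τ, QSphere.IsChernTrace hq τ → τ = τ₁) ∧
      AlgK0.IsTrace (QSphere.tau0 hq) ∧ AlgK0.IsTrace τ₁ ∧
      -- the pairing `[e] ↦ (τ⁰ (Tr e), τ¹ (Tr e))` is a homomorphism `K₀(A(S_q²)) → ℤ × ℤ`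
      ∃ pairing : AlgK0.K0 (QSphere.sphere q hq) →+ ℤ × ℤ,
        (∀ (n : ℕ) (e : Matrix (Fin n) (Fin n) (QSphere.sphere q hq)) (he : IsIdempotentElem e),
          ((pairing (AlgK0.cls e he)).1 : ℂ) = QSphere.tau0 hq e.trace ∧
          ((pairing (AlgK0.cls e he)).2 : ℂ) = τ₁ e.trace) ∧
        -- the image of the positive cone contains `{1, 2, …} × ℤ`
        {p : ℤ × ℤ | 0 < p.1} ⊆ pairing '' AlgK0.positiveCone (QSphere.sphere q hq) ∧
        -- the witness for `(m + 1, μ)` is `[e_μ] + m [1]`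
        ∀ μ : ℤ, ∃ he : IsIdempotentElem (QSphere.hopfProj hq μ), ∀ m : ℕ,
          AlgK0.cls (QSphere.hopfProj hq μ) he +
              m • AlgK0.cls (1 : Matrix (Fin 1) (Fin 1) (QSphere.sphere q hq)) .one ∈
            AlgK0.positiveCone (QSphere.sphere q hq) ∧
          pairing (AlgK0.cls (QSphere.hopfProj hq μ) he +
              m • AlgK0.cls (1 : Matrix (Fin 1) (Fin 1) (QSphere.sphere q hq)) .one) =
            ((m : ℤ) + 1, μ) := by
  have h := QSphere.isChernTrace_chernTrace hq
  have h0 : AlgK0.IsTrace (QSphere.tau0 hq) := fun x y => by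
    simp only [QSphere.tau0, AlgHom.toLinearMap_apply, map_mul, mul_comm]
  have h1 : AlgK0.IsTrace (QSphere.chernTrace hq) := h.isTrace hroot
  have hint0 (v : AlgK0.V (QSphere.sphere q hq)) : ∃ m : ℤ, AlgK0.traceV h0 v = m := by
    obtain ⟨e⟩ := v
    exact QSphere.exists_tau0_trace_eq_intCast hq e.idem
  have hint1 (v : AlgK0.V (QSphere.sphere q hq)) : ∃ m : ℤ, AlgK0.traceV h1 v = m := by
    obtain ⟨e⟩ := v
    exact h.exists_trace_eq_intCast hroot e.idem
  let pairing := (AlgK0.tracePairing h0 hint0).prod (AlgK0.tracePairing h1 hint1)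
  have hpairing (n : ℕ) (e : Matrix (Fin n) (Fin n) (QSphere.sphere q hq))
      (he : IsIdempotentElem e) :
      ((pairing (AlgK0.cls e he)).1 : ℂ) = QSphere.tau0 hq e.trace ∧
        ((pairing (AlgK0.cls e he)).2 : ℂ) = QSphere.chernTrace hq e.trace :=
    ⟨AlgK0.tracePairing_cls h0 hint0 e he, AlgK0.tracePairing_cls h1 hint1 e he⟩
  have hone : pairing (AlgK0.cls (1 : Matrix (Fin 1) (Fin 1) (QSphere.sphere q hq)) .one) =
      (1, 0) := by
    obtain ⟨hl, hr⟩ := hpairing 1 1 .one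
    rw [Matrix.trace_one, Fintype.card_fin, Nat.cast_one] at hl hr
    refine Prod.ext (Int.cast_injective (α := ℂ) (hl.trans ?_))
      (Int.cast_injective (α := ℂ) (hr.trans ?_))
    · simp [QSphere.tau0]
    -- `τ¹(1)` is the value at `ζ⁰`, namely `0`; this is why adding copies of `[1]` leaves the
    -- second coordinate unchanged.
    · simpa using h.apply_zeta_pow 0
  have hhopf (μ : ℤ) : pairing (AlgK0.cls (QSphere.hopfProj hq μ)
      (QSphere.isIdempotentElem_hopfProj hq hroot μ)) = (1, μ) := by
    obtain ⟨hl, hr⟩ := hpairing _ _ (QSphere.isIdempotentElem_hopfProj hq hroot μ)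
    refine Prod.ext (Int.cast_injective (α := ℂ) (hl.trans ?_))
      (Int.cast_injective (α := ℂ) (hr.trans (h.apply_trace_hopfProj hroot μ)))
    rw [QSphere.tau0_trace_hopfProj hq hroot, Int.cast_one]
  have hmain (μ : ℤ) (m : ℕ) :
      AlgK0.cls (QSphere.hopfProj hq μ) (QSphere.isIdempotentElem_hopfProj hq hroot μ) +
            m • AlgK0.cls (1 : Matrix (Fin 1) (Fin 1) (QSphere.sphere q hq)) .one ∈
          AlgK0.positiveCone (QSphere.sphere q hq) ∧
        pairing
            (AlgK0.cls (QSphere.hopfProj hq μ) (QSphere.isIdempotentElem_hopfProj hq hroot μ) +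
              m • AlgK0.cls (1 : Matrix (Fin 1) (Fin 1) (QSphere.sphere q hq)) .one) =
          ((m : ℤ) + 1, μ) := by
    refine ⟨AlgK0.add_nsmul_mem_positiveCone (AlgK0.cls_mem_positiveCone _ _)
      (AlgK0.cls_mem_positiveCone _ _) m, ?_⟩
    rw [map_add, map_nsmul, hone, hhopf]
    ext <;> simp [add_comm]
  refine ⟨QSphere.chernTrace hq, ⟨h, fun τ hτ => hτ.ext h⟩, h0, h1, pairing, hpairing, ?_,
    fun μ => ⟨QSphere.isIdempotentElem_hopfProj hq hroot μ, hmain μ⟩⟩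
  rintro ⟨n, μ⟩ hn
  -- One unit of the first coordinate comes from `[e_μ]`, the remaining `m` from copies of `[1]`.
  obtain ⟨m, rfl⟩ := Int.eq_succ_of_zero_lt hn
  exact ⟨_, (hmain μ m).1, (hmain μ m).2⟩
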